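/- Let $\mathfrak g=\mathfrak g_{\bar 0}\oplus\mathfrak g_{\bar 1}$ be a finite-dimensional complex Lie superalgebra. A $\mathfrak g$-module is a $\mathbb Z_2$-graded complex vector space $M$ with a homomorphism of Lie superalgebras $\mathfrak g\to\mathfrak{gl}(M)$, and $M\otimes N$ carries the action $x(m\otimes n)=xm\otimes n+(-1)^{\bar x\bar m}m\otimes xn$. For a Lie subalgebra $\mathfrak a\le\mathfrak g_{\bar 0}$ and a $\mathfrak g$-module $B$, let $H^n(\mathfrak g,\mathfrak a;B)$ be the cohomology of the relative Koszul complex $C^n(\mathfrak g,\mathfrak a;B)=\operatorname{Hom}_{\mathfrak a}(\Lambda_s^n(\mathfrak g/\mathfrak a),B)$, where $\Lambda_s^n(V_{\bar 0}\oplus V_{\bar 1})=\bigoplus_{p+q=n}\Lambda^p(V_{\bar 0})\otimes S^q(V_{\bar 1})$ and $$df(\omega_0\wedge\cdots\wedge\omega_n)=\sum_i(-1)^{i+\bar\omega_i(\bar\omega_0+\cdots+\bar\omega_{i-1}+\bar f)}\,\omega_i.f(\omega_0\wedge\cdots\hat\omega_i\cdots\wedge\omega_n)+\sum_{i<j}(-1)^{i+j+\bar\omega_i\bar\omega_j+\bar\omega_i(\bar\omega_0+\cdots+\bar\omega_{i-1})+\bar\omega_j(\bar\omega_0+\cdots+\bar\omega_{j-1})}f([\omega_i,\omega_j]\wedge\omega_0\wedge\cdots\hat\omega_i\cdots\hat\omega_j\cdots\wedge\omega_n).$$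 Put $H^{ev}(\mathfrak g,\mathfrak a;\mathbb C)=\bigoplus_n H^{2n}(\mathfrak g,\mathfrak a;\mathbb C)$, a ring under the cup product, and $\operatorname{Ext}^\bullet_{(\mathfrak g,\mathfrak a)}(M,M)=H^\bullet(\mathfrak g,\mathfrak a;\operatorname{End}_{\mathbb C}(M))$, on which $H^{ev}(\mathfrak g,\mathfrak a;\mathbb C)$ acts by the cup product. The cohomology variety $\mathcal V_{(\mathfrak g,\mathfrak a)}(\mathbb C)$ is the set of maximal ideals of $H^{ev}(\mathfrak g,\mathfrak a;\mathbb C)$, and the support variety $\mathcal V_{(\mathfrak g,\mathfrak a)}(M)\subseteq\mathcal V_{(\mathfrak g,\mathfrak a)}(\mathbb C)$ is the set of those that contain the annihilator of $\operatorname{Ext}^\bullet_{(\mathfrak g,\mathfrak a)}(M,M)$. Let $\Phi:\mathcal V_{(\mathfrak g,\mathfrak a)}(\mathbb C)\to\mathcal V_{(\mathfrak g,\mathfrak g_{\bar 0})}(\mathbb C)$ be the map induced by the restriction $H^{ev}(\mathfrak g,\mathfrak g_{\bar 0};\mathbb C)\to H^{ev}(\mathfrak g,\mathfrak a;\mathbb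 C)$. Fix a class $\mathcal C$ of $\mathfrak g$-modules that is closed under tensor products (for example all $\mathfrak g$-modules, or all finite-dimensional ones). The pair $(\mathfrak g,\mathfrak g_{\bar 0})$ satisfies the tensor product theorem if $\mathcal V_{(\mathfrak g,\mathfrak g_{\bar 0})}(M\otimes N)=\mathcal V_{(\mathfrak g,\mathfrak g_{\bar 0})}(M)\cap\mathcal V_{(\mathfrak g,\mathfrak g_{\bar 0})}(N)$ for all $M,N\in\mathcal C$. A subalgebra $\mathfrak a\le\mathfrak g_{\bar 0}$ is natural if $\mathcal V_{(\mathfrak g,\mathfrak g_{\bar 0})}(M)\cap\Phi(\mathcal V_{(\mathfrak g,\mathfrak a)}(\mathbb C))=\Phi(\mathcal V_{(\mathfrak g,\mathfrak a)}(M))$ for all $M\in\mathcal C$. **Proposition.** Suppose that $(\mathfrak g,\mathfrak g_{\bar 0})$ satisfies the tensor product theorem and that $\mathfrak a\le\mathfrak g_{\bar 0}$ is a natural subalgebra. Then for all $M,N\in\mathcal C$, $$\Phi(\mathcal V_{(\mathfrak g,\mathfrak a)}(M\otimes N))=\Phi(\mathcal V_{(\mathfrak g,\mathfrak a)}(M))\cap\Phi(\mathcal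 V_{(\mathfrak g,\mathfrak a)}(N)).$$ -/

import Mathlib

open scoped TensorProduct

universe u v

noncomputable section

set_option linter.unusedSectionVars false

namespace SuperCohomology

/-- The sign `(-1)^i` attached to a parity `i ∈ ℤ/2`. -/
def sgn (i : ZMod 2) : ℂ := if i = 0 then 1 else -1

theorem zmod_two_cases (i : ZMod 2) : i = 0 ∨ i = 1 := by
  revert i; decide

@[simp] theorem sgn_zero : sgn 0 = 1 := by simp [sgn]

@[simp] theorem sgn_one : sgn 1 = -1 := by simp [sgn]

theorem sgn_add (i j : ZMod 2) : sgn (i + j) = sgn i * sgn j := by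
  have h : (1 : ZMod 2) + 1 = 0 := by decide
  rcases zmod_two_cases i with rfl | rfl <;> rcases zmod_two_cases j with rfl | rfl <;> simp [h]

theorem sgn_cases (i : ZMod 2) : sgn i = 1 ∨ sgn i = -1 := by
  rcases zmod_two_cases i with rfl | rfl <;> simp

theorem sgn_mul_self (i : ZMod 2) : sgn i * sgn i = 1 := by
  rcases zmod_two_cases i with rfl | rfl <;> simp

/-- A complex Lie superalgebra: a `ℤ/2`-graded vector space `g = g₀ ⊕ g₁` with a bilinear bracket
that respects the grading, is super-anticommutative and satisfies the super Jacobi identity. -/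
class LieSuperalgebra (g : Type u) [AddCommGroup g] [Module ℂ g] where
  part : ZMod 2 → Submodule ℂ g
  isCompl : IsCompl (part 0) (part 1)
  bracket : g →ₗ[ℂ] g →ₗ[ℂ] g
  bracket_mem : ∀ {i j : ZMod 2} {x y : g}, x ∈ part i → y ∈ part j → bracket x y ∈ part (i + j)
  skew : ∀ {i j : ZMod 2} {x y : g}, x ∈ part i → y ∈ part j →
    bracket x y + sgn (i * j) • bracket y x = 0
  jacobi : ∀ {i j : ZMod 2} {x y z : g}, x ∈ part i → y ∈ part j →
    bracket x (bracket y z) = bracket (bracket x y) z + sgn (i * j) • bracket y (bracket x z)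

open LieSuperalgebra

/-- A homogeneous element of `g`, together with its parity. -/
@[ext] structure Homog (g : Type u) [AddCommGroup g] [Module ℂ g] [LieSuperalgebra g] where
  par : ZMod 2
  val : g
  mem : val ∈ part par

section
variable {g : Type u} [AddCommGroup g] [Module ℂ g] [LieSuperalgebra g]

/-- The bracket of homogeneous elements. -/
def Homog.br (x y : Homog g) : Homog g := ⟨x.par + y.par, bracket x.val y.val, bracket_mem x.mem y.mem⟩

end

/-- A `g`-module superalgebra `B`: the `ℤ/2`-grading of the associative algebra `B` is recorded by
the parity automorphism `σ` (which is `(-1)^i` on the part of parity `i`), and `g` acts by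
superderivations. -/
class GSuperalgebra (g : Type u) [AddCommGroup g] [Module ℂ g] [LieSuperalgebra g]
    (B : Type v) [Ring B] [Algebra ℂ B] where
  σ : B →ₐ[ℂ] B
  σ_σ : ∀ b, σ (σ b) = b
  act : Homog g → B →ₗ[ℂ] B
  act_lin : ∀ (c : ℂ) (x y z : Homog g), y.par = x.par → z.par = x.par →
    x.val = c • y.val + z.val → act x = c • act y + act z
  σ_act : ∀ x b, σ (act x b) = sgn x.par • act x (σ b)
  act_mul : ∀ x b c, act x (b * c) = act x b * c + (if x.par = 0 then b else σ b) * act x c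
  act_br : ∀ x y b, act (x.br y) b = act x (act y b) - sgn (x.par * y.par) • act y (act x b)

section twist
variable (g : Type u) [AddCommGroup g] [Module ℂ g] [LieSuperalgebra g]
    {B : Type v} [Ring B] [Algebra ℂ B] [GSuperalgebra g B]

/-- The operator on `B` that is multiplication by `(-1)^(i * j)` on the part of parity `j`. -/
def twB (i : ZMod 2) : B →ₐ[ℂ] B := if i = 0 then AlgHom.id ℂ B else GSuperalgebra.σ g

theorem twB_zero (b : B) : twB g 0 b = b := by simp [twB]

theorem twB_one (b : B) : twB g 1 b = GSuperalgebra.σ g b := by simp [twB]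

theorem twB_twB (i j : ZMod 2) (b : B) : twB g i (twB g j b) = twB g (i + j) b := by
  have h : (1 : ZMod 2) + 1 = 0 := by decide
  rcases zmod_two_cases i with rfl | rfl <;> rcases zmod_two_cases j with rfl | rfl <;>
    simp [h, twB_zero, twB_one, GSuperalgebra.σ_σ]

variable {g}

theorem twB_act (i : ZMod 2) (x : Homog g) (b : B) :
    twB g i (GSuperalgebra.act x b) = sgn (i * x.par) • GSuperalgebra.act x (twB g i b) := by
  rcases zmod_two_cases i with rfl | rfl <;> simp [twB_zero, twB_one, GSuperalgebra.σ_act]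

theorem act_mul (x : Homog g) (b c : B) : GSuperalgebra.act x (b * c) =
    GSuperalgebra.act x b * c + twB g x.par b * GSuperalgebra.act x c := by
  rw [GSuperalgebra.act_mul]
  rcases zmod_two_cases x.par with h | h <;> simp [h, twB_zero, twB_one]

end twist

/-- `B`-valued functions on words of homogeneous elements of `g`.  A multilinear map on `g × ⋯ × g`
(`n` factors) is determined by its values on homogeneous arguments, so it is the same as a function on
words of length `n` that is linear in each homogeneous argument; a function on all words is a family
with one such component for each `n`. -/
def Pre (g : Type u) [AddCommGroup g] [Module ℂ g] [LieSuperalgebra g] (B : Type v) : Type max u v :=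
  List (Homog g) → B

namespace Pre

section
variable {g : Type u} [AddCommGroup g] [Module ℂ g] [LieSuperalgebra g]
    {B : Type v} [Ring B] [Algebra ℂ B]

instance : AddCommGroup (Pre g B) := inferInstanceAs (AddCommGroup (List (Homog g) → B))
instance : Module ℂ (Pre g B) := inferInstanceAs (Module ℂ (List (Homog g) → B))

@[simp] theorem add_apply (f h : Pre g B) (l) : (f + h) l = f l + h l := rfl
@[simp] theorem sub_apply (f h : Pre g B) (l) : (f - h) l = f l - h l := rfl
@[simp] theorem neg_apply (f : Pre g B) (l) : (-f) l = -f l := rfl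
@[simp] theorem zero_apply (l) : (0 : Pre g B) l = 0 := rfl
@[simp] theorem smul_apply (c : ℂ) (f : Pre g B) (l) : (c • f) l = c • f l := rfl

/-- Insertion of a first argument: `ι x f (w₁, …, wₙ) = f (x, w₁, …, wₙ)`. -/
def ι (x : Homog g) : Pre g B →ₗ[ℂ] Pre g B where
  toFun f := fun l => f (x :: l)
  map_add' _ _ := rfl
  map_smul' _ _ := rfl

theorem ι_apply (x : Homog g) (f : Pre g B) (l) : ι x f l = f (x :: l) := rfl

theorem ext_ι {f h : Pre g B} (h0 : f [] = h []) (h1 : ∀ x, ι x f = ι x h) : f = h := by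
  funext l
  cases l with
  | nil => exact h0
  | cons x l => exact congrFun (h1 x) l

/-- Multiplication by `(-1)^n` in degree `n`. -/
def ε : Pre g B →ₗ[ℂ] Pre g B where
  toFun f := fun l => ((-1 : ℂ) ^ l.length) • f l
  map_add' f h := by
    funext l
    simp only [add_apply, smul_add]
    rfl
  map_smul' c f := by
    funext l
    simp only [smul_apply, RingHom.id_apply]
    exact smul_comm _ _ _

theorem ε_apply (f : Pre g B) (l) : ε f l = ((-1 : ℂ) ^ l.length) • f l := rfl

@[simp] theorem ε_nil (f : Pre g B) : ε f [] = f [] := by simp [ε_apply]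

theorem ι_ε (x : Homog g) (f : Pre g B) : ι x (ε f) = -ε (ι x f) := by
  funext l; simp [ι_apply, ε_apply, pow_succ]

@[simp] theorem ε_ε (f : Pre g B) : ε (ε f) = f := by
  funext l
  rw [ε_apply, ε_apply, smul_smul, ← mul_pow]; simp

end

/-- The total parity of a word. -/
def parity {g : Type u} [AddCommGroup g] [Module ℂ g] [LieSuperalgebra g] (l : List (Homog g)) :
    ZMod 2 := (l.map Homog.par).sum

section
variable {g : Type u} [AddCommGroup g] [Module ℂ g] [LieSuperalgebra g]
    {B : Type v} [Ring B] [Algebra ℂ B] [GSuperalgebra g B]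

/-- Multiplication by `(-1)^(i * j)` on functions of parity `j`.  A function `f` has parity `j` when
`f l` has parity `j + parity l` for every word `l`. -/
def tw (i : ZMod 2) : Pre g B →ₗ[ℂ] Pre g B where
  toFun f := fun l => sgn (i * parity l) • twB g i (f l)
  map_add' f h := by
    funext l
    simp only [add_apply, map_add, smul_add]
    rfl
  map_smul' c f := by
    funext l
    simp only [smul_apply, map_smul, RingHom.id_apply]
    exact smul_comm _ _ _

theorem tw_apply (i : ZMod 2) (f : Pre g B) (l) :
    tw i f l = sgn (i * parity l) • twB g i (f l) := rfl

@[simp] theorem tw_nil (i : ZMod 2) (f : Pre g B) : tw i f [] = twB g i (f []) := by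
  simp [tw_apply, parity]

theorem tw_zero (f : Pre g B) : tw 0 f = f := by
  funext l; simp [tw_apply, twB_zero]

theorem ι_tw (x : Homog g) (i : ZMod 2) (f : Pre g B) :
    ι x (tw i f) = sgn (i * x.par) • tw i (ι x f) := by
  funext l
  simp [ι_apply, tw_apply, parity, mul_add, sgn_add, mul_smul]

theorem tw_tw (i j : ZMod 2) (f : Pre g B) : tw i (tw j f) = tw (i + j) f := by
  funext l
  simp [tw_apply, twB_twB, add_mul, sgn_add, mul_smul]

theorem tw_ε (i : ZMod 2) (f : Pre g B) : tw i (ε f) = ε (tw i f) := by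
  funext l
  simp [tw_apply, ε_apply, smul_comm (sgn _)]

/-- Evaluation of the cup product, the signed sum over all ways of distributing the arguments over
`f` and `h`:
`(f ∪ h)(w₁, …, wₙ) = ∑ ± f(w_{i₁}, …, w_{iₚ}) h(w_{j₁}, …, w_{jᵣ})`, over the decompositions of
`{1, …, n}` into `i₁ < ⋯ < iₚ` and `j₁ < ⋯ < jᵣ`.  The sign is given by the Koszul rule for the parities
(with `h` moved past the arguments of `f`) times the sign of the shuffle.  The recursion treats the
first argument `x`, which goes either to `f` or to `h`:
`(f ∪ h)(x, …) = (f(x, …) ∪ (-1)^(x̄ h̄) h)(…) + (-1)^(deg f) (f ∪ h(x, …))(…)`. -/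
def cupAux : List (Homog g) → Pre g B → Pre g B → B
  | [], f, h => f [] * h []
  | x :: l, f, h => cupAux l (ι x f) (tw x.par h) + cupAux l (ε f) (ι x h)

/-- The cup product. -/
instance : Mul (Pre g B) := ⟨fun f h => fun l => cupAux l f h⟩

theorem mul_nil (f h : Pre g B) : (f * h) [] = f [] * h [] := rfl

theorem mul_cons (f h : Pre g B) (x l) :
    (f * h) (x :: l) = (ι x f * tw x.par h) l + (ε f * ι x h) l := rfl

theorem ι_mul (x : Homog g) (f h : Pre g B) :
    ι x (f * h) = ι x f * tw x.par h + ε f * ι x h := rfl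

theorem add_mul_apply (l) : ∀ f₁ f₂ h : Pre g B, ((f₁ + f₂) * h) l = (f₁ * h) l + (f₂ * h) l := by
  induction l with
  | nil => intros; simp [mul_nil, add_mul]
  | cons x l ih => intros; simp only [mul_cons, map_add, ih]; abel

theorem mul_add_apply (l) : ∀ f h₁ h₂ : Pre g B, (f * (h₁ + h₂)) l = (f * h₁) l + (f * h₂) l := by
  induction l with
  | nil => intros; simp [mul_nil, mul_add]
  | cons x l ih => intros; simp only [mul_cons, map_add, ih]; abel

theorem smul_mul_apply (l) : ∀ (c : ℂ) (f h : Pre g B), ((c • f) * h) l = c • (f * h) l := by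
  induction l with
  | nil => intros; simp [mul_nil]
  | cons x l ih => intros; simp only [mul_cons, map_smul, ih, smul_add]

theorem mul_smul_apply (l) : ∀ (c : ℂ) (f h : Pre g B), (f * (c • h)) l = c • (f * h) l := by
  induction l with
  | nil => intros; simp [mul_nil]
  | cons x l ih => intros; simp only [mul_cons, map_smul, ih, smul_add]

instance : NonUnitalNonAssocRing (Pre g B) :=
  { (inferInstance : AddCommGroup (Pre g B)), (inferInstance : Mul (Pre g B)) with
    left_distrib := fun f h₁ h₂ => funext fun l => mul_add_apply l f h₁ h₂
    right_distrib := fun f₁ f₂ h => funext fun l => add_mul_apply l f₁ f₂ h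
    zero_mul := fun f => by
      funext l; simpa using smul_mul_apply l 0 0 f
    mul_zero := fun f => by
      funext l; simpa using mul_smul_apply l 0 f 0 }

instance : IsScalarTower ℂ (Pre g B) (Pre g B) :=
  ⟨fun c f h => funext fun l => smul_mul_apply l c f h⟩

instance : SMulCommClass ℂ (Pre g B) (Pre g B) :=
  ⟨fun c f h => funext fun l => (mul_smul_apply l c f h).symm⟩

theorem tw_mul (i : ZMod 2) (f h : Pre g B) : tw i (f * h) = tw i f * tw i h := by
  funext l
  induction l generalizing f h with
  | nil => simp [mul_nil]
  | cons x l ih =>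
    have e (k : Pre g B) : k (x :: l) = ι x k l := rfl
    simp only [e, ι_tw, ι_mul, map_add, smul_apply, add_apply, ih, tw_tw, ← tw_ε,
      smul_mul_assoc, mul_smul_comm, smul_add]
    rw [add_comm i]

theorem ε_mul (f h : Pre g B) : ε (f * h) = ε f * ε h := by
  funext l
  induction l generalizing f h with
  | nil => simp [mul_nil]
  | cons x l ih =>
    have e (k : Pre g B) : k (x :: l) = ι x k l := rfl
    simp only [e, ι_ε, ι_mul, map_add, neg_apply, add_apply, ih, tw_ε, mul_neg, neg_mul]
    abel

theorem mul_assoc_apply (l) : ∀ f h k : Pre g B, (f * h * k) l = (f * (h * k)) l := by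
  induction l with
  | nil => intros; simp [mul_nil, mul_assoc]
  | cons x l ih =>
    intro f h k
    have e (k : Pre g B) : k (x :: l) = ι x k l := rfl
    simp only [e, ι_mul, tw_mul, ε_mul, add_mul, mul_add, add_apply, ih]
    abel

instance : One (Pre g B) := ⟨fun l => if l = [] then 1 else 0⟩

theorem one_nil : (1 : Pre g B) [] = 1 := if_pos rfl

theorem ι_one (x : Homog g) : ι x (1 : Pre g B) = 0 := by
  funext l; exact if_neg (c := x :: l = []) (t := (1 : B)) (List.cons_ne_nil x l)

theorem tw_one (i : ZMod 2) : tw i (1 : Pre g B) = 1 :=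
  ext_ι (by simp [one_nil]) fun x => by simp [ι_tw, ι_one]

theorem ε_one : ε (1 : Pre g B) = 1 :=
  ext_ι (by simp [one_nil]) fun x => by simp [ι_ε, ι_one]

instance : Ring (Pre g B) :=
  { (inferInstance : NonUnitalNonAssocRing (Pre g B)), (inferInstance : One (Pre g B)) with
    mul_assoc := fun f h k => funext fun l => mul_assoc_apply l f h k
    one_mul := fun f => by
      funext l
      induction l generalizing f with
      | nil => simp [mul_nil, one_nil]
      | cons x l ih => simp [mul_cons, ι_one, ε_one, ih, ι_apply]
    mul_one := fun f => by
      funext l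
      induction l generalizing f with
      | nil => simp [mul_nil, one_nil]
      | cons x l ih => simp [mul_cons, ι_one, tw_one, ih, ι_apply] }

instance : Algebra ℂ (Pre g B) :=
  Algebra.ofModule (fun c f h => smul_mul_assoc c f h) (fun c f h => mul_smul_comm c f h)


/-- The Lie derivative along a homogeneous element `x`:
`(L_x f)(w₁, …, wₙ) = (-1)^(x̄ f̄) x.f(w₁, …, wₙ)
  - ∑ⱼ (-1)^(x̄ (w̄₁ + ⋯ + w̄ⱼ₋₁)) f(w₁, …, [x, wⱼ], …, wₙ)`. -/
def lie (x : Homog g) (f : Pre g B) : Pre g B := fun l =>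
  GSuperalgebra.act x (tw x.par f l) -
    ∑ j : Fin l.length, sgn (x.par * parity (l.take j)) • f (l.set j (x.br l[j]))

theorem lie_nil (x : Homog g) (f : Pre g B) :
    lie x f [] = GSuperalgebra.act x (twB g x.par (f [])) := by
  simp [lie]

theorem ι_lie (x y : Homog g) (f : Pre g B) :
    ι y (lie x f) = sgn (x.par * y.par) • lie x (ι y f) - ι (x.br y) f := by
  funext l
  have h : tw x.par f (y :: l) = sgn (x.par * y.par) • tw x.par (ι y f) l :=
    congrFun (ι_tw y x.par f) l
  simp only [ι_apply, lie, h, map_smul, sub_apply, smul_apply]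
  erw [Fin.sum_univ_succ]
  simp [parity, mul_add, sgn_add, mul_smul, smul_sub, Finset.smul_sum]
  abel

theorem lie_add_apply (x : Homog g) (l) :
    ∀ f h : Pre g B, lie x (f + h) l = lie x f l + lie x h l := by
  intro f h
  simp [lie, Finset.sum_add_distrib]
  abel

/-- The Lie derivative as a linear map. -/
def L (x : Homog g) : Pre g B →ₗ[ℂ] Pre g B where
  toFun := lie x
  map_add' f h := funext fun l => lie_add_apply x l f h
  map_smul' c f := by
    funext l
    simp [lie, smul_sub, Finset.smul_sum, smul_comm c]

theorem L_nil (x : Homog g) (f : Pre g B) :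
    L x f [] = GSuperalgebra.act x (twB g x.par (f [])) := lie_nil x f

theorem ι_L (x y : Homog g) (f : Pre g B) :
    ι y (L x f) = sgn (x.par * y.par) • L x (ι y f) - ι (x.br y) f := ι_lie x y f

theorem L_ε (x : Homog g) (f : Pre g B) : L x (ε f) = ε (L x f) := by
  funext l
  induction l generalizing f with
  | nil => simp [L_nil]
  | cons y l ih =>
    have e (k : Pre g B) : k (y :: l) = ι y k l := rfl
    simp only [e, ι_ε, ι_L, map_sub, map_smul, map_neg, neg_apply, sub_apply, smul_apply, ih, smul_neg]
    abel

theorem tw_L (i : ZMod 2) (x : Homog g) (f : Pre g B) :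
    tw i (L x f) = sgn (i * x.par) • L x (tw i f) := by
  funext l
  induction l generalizing f with
  | nil => simp [L_nil, twB_act, twB_twB, add_comm i]
  | cons y l ih =>
    have e (k : Pre g B) : k (y :: l) = ι y k l := rfl
    have h : (x.br y).par = x.par + y.par := rfl
    simp only [e, ι_tw, ι_L, map_sub, map_smul, sub_apply, smul_apply, ih, h, mul_add, sgn_add]
    rcases sgn_cases (i * x.par) with h | h <;> rw [h] <;> module

theorem L_mul (x : Homog g) (f h : Pre g B) :
    L x (f * h) = L x f * tw x.par h + f * L x h := by
  funext l
  induction l generalizing f h with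
  | nil => simp [L_nil, mul_nil, act_mul, twB_twB, CharTwo.add_self_eq_zero, twB_zero]
  | cons y l ih =>
    have e (k : Pre g B) : k (y :: l) = ι y k l := rfl
    have hb : (x.br y).par = x.par + y.par := rfl
    simp only [e, ι_L, ι_mul, ι_tw, map_add, sub_apply, add_apply, smul_apply, ih, tw_L, tw_tw, hb,
      L_ε, sub_mul, mul_sub, smul_mul_assoc, mul_smul_comm, mul_comm y.par x.par,
      add_comm y.par x.par]
    rcases sgn_cases (x.par * y.par) with h | h <;> rw [h] <;> module

/-- Recursive form of the coboundary, through Cartan's formula. -/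
def dAux : List (Homog g) → Pre g B → B
  | [], _ => 0
  | x :: l, f => L x f l - dAux l (ι x f)

theorem dAux_add (l) : ∀ f h : Pre g B, dAux l (f + h) = dAux l f + dAux l h := by
  induction l with
  | nil => intros; simp [dAux]
  | cons x l ih => intros; simp only [dAux, map_add, ih, add_apply]; abel

theorem dAux_smul (l) : ∀ (c : ℂ) (f : Pre g B), dAux l (c • f) = c • dAux l f := by
  induction l with
  | nil => intros; simp [dAux]
  | cons x l ih => intros; simp only [dAux, map_smul, ih, smul_apply, smul_sub]

/-- Recursive form of the coboundary, as a linear map. -/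
def D : Pre g B →ₗ[ℂ] Pre g B where
  toFun f := fun l => dAux l f
  map_add' f h := funext fun l => dAux_add l f h
  map_smul' c f := funext fun l => dAux_smul l c f

theorem D_nil (f : Pre g B) : D f [] = 0 := rfl

theorem ι_D (x : Homog g) (f : Pre g B) : ι x (D f) = L x f - D (ι x f) := rfl

theorem D_ε (f : Pre g B) : D (ε f) = -ε (D f) := by
  funext l
  induction l generalizing f with
  | nil => simp [D_nil]
  | cons y l ih =>
    have e (k : Pre g B) : k (y :: l) = ι y k l := rfl
    simp only [e, ι_D, ι_ε, map_sub, map_neg, neg_apply, sub_apply, ih, L_ε]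
    abel

theorem tw_D (i : ZMod 2) (f : Pre g B) : tw i (D f) = D (tw i f) := by
  funext l
  induction l generalizing f with
  | nil => simp [D_nil]
  | cons y l ih =>
    have e (k : Pre g B) : k (y :: l) = ι y k l := rfl
    simp only [e, ι_D, ι_tw, map_sub, map_smul, smul_apply, sub_apply, ih, tw_L]
    rcases sgn_cases (i * y.par) with h | h <;> rw [h] <;> module

theorem D_mul (f h : Pre g B) : D (f * h) = D f * h + ε f * D h := by
  funext l
  induction l generalizing f h with
  | nil => simp [D_nil, mul_nil]
  | cons y l ih =>
    have e (k : Pre g B) : k (y :: l) = ι y k l := rfl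
    simp only [e, ι_D, ι_mul, ι_ε, map_add, sub_apply, add_apply, ih, tw_D, D_ε, L_mul,
      sub_mul, mul_sub, neg_mul, neg_apply, ε_ε]
    abel

/-- Functions on words that are linear in every argument. -/
def Lin (f : Pre g B) : Prop :=
  ∀ (l l' : List (Homog g)) (c : ℂ) (x y z : Homog g), y.par = x.par → z.par = x.par →
    x.val = c • y.val + z.val → f (l ++ x :: l') = c • f (l ++ y :: l') + f (l ++ z :: l')

/-- Functions on words that are super-alternating. -/
def Alt (f : Pre g B) : Prop :=
  ∀ (l l' : List (Homog g)) (x y : Homog g),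
    f (l ++ x :: y :: l') = -(sgn (x.par * y.par) • f (l ++ y :: x :: l'))

variable (g B) in
/-- The multilinear super-alternating functions. -/
def LA : Submodule ℂ (Pre g B) where
  carrier := {f | Lin f ∧ Alt f}
  add_mem' := by
    rintro f h ⟨hf, hf'⟩ ⟨hh, hh'⟩
    refine ⟨fun l l' c x y z h1 h2 h3 => ?_, fun l l' x y => ?_⟩
    · rw [add_apply, hf l l' c x y z h1 h2 h3, hh l l' c x y z h1 h2 h3, add_apply, add_apply]
      module
    · rw [add_apply, hf' l l' x y, hh' l l' x y, add_apply]
      module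
  zero_mem' := ⟨fun _ _ _ _ _ _ _ _ _ => by simp, fun _ _ _ _ => by simp⟩
  smul_mem' := by
    rintro a f ⟨hf, hf'⟩
    refine ⟨fun l l' c x y z h1 h2 h3 => ?_, fun l l' x y => ?_⟩
    · rw [smul_apply, hf l l' c x y z h1 h2 h3, smul_apply, smul_apply]
      module
    · rw [smul_apply, hf' l l' x y, smul_apply]
      module

variable (g B) in
/-- The functions that are linear and super-alternating in the first arguments. -/
def HLA : Submodule ℂ (Pre g B) where
  carrier := {f | (∀ (c : ℂ) (x y z : Homog g), y.par = x.par → z.par = x.par →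
    x.val = c • y.val + z.val → ι x f = c • ι y f + ι z f) ∧
    ∀ x y, ι y (ι x f) = -(sgn (x.par * y.par) • ι x (ι y f))}
  add_mem' := by
    rintro f h ⟨hf, hf'⟩ ⟨hh, hh'⟩
    refine ⟨fun c x y z h1 h2 h3 => ?_, fun x y => ?_⟩
    · rw [map_add, hf c x y z h1 h2 h3, hh c x y z h1 h2 h3, map_add, map_add]
      module
    · simp only [map_add, hf' x y, hh' x y]
      module
  zero_mem' := ⟨fun _ _ _ _ _ _ _ => by simp, fun _ _ => by simp⟩
  smul_mem' := by
    rintro a f ⟨hf, hf'⟩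
    refine ⟨fun c x y z h1 h2 h3 => ?_, fun x y => ?_⟩
    · rw [map_smul, hf c x y z h1 h2 h3, map_smul, map_smul]
      module
    · simp only [map_smul, hf' x y]
      module

theorem LA_le_HLA : LA g B ≤ HLA g B := fun _ hf =>
  ⟨fun c x y z h1 h2 h3 => funext fun l => hf.1 [] l c x y z h1 h2 h3,
    fun x y => funext fun l => hf.2 [] l x y⟩

theorem ι_mem_LA (x : Homog g) {f : Pre g B} (hf : f ∈ LA g B) : ι x f ∈ LA g B :=
  ⟨fun l l' => hf.1 (x :: l) l', fun l l' => hf.2 (x :: l) l'⟩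

theorem le_LA (P : Submodule ℂ (Pre g B)) (hP : P ≤ HLA g B)
    (hι : ∀ x, ∀ f ∈ P, ι x f ∈ P) : P ≤ LA g B := by
  intro f hf
  refine ⟨fun l => ?_, fun l => ?_⟩
  · induction l generalizing f with
    | nil => exact fun l' c x y z h1 h2 h3 => congrFun ((hP hf).1 c x y z h1 h2 h3) l'
    | cons w l ih => exact ih (hι w f hf)
  · induction l generalizing f with
    | nil => exact fun l' x y => congrFun ((hP hf).2 x y) l'
    | cons w l ih => exact ih (hι w f hf)

theorem map_mem_LA (T : Pre g B →ₗ[ℂ] Pre g B) (hT : ∀ f ∈ LA g B, T f ∈ HLA g B)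
    (hι : ∀ x, ∀ f ∈ LA g B, ∃ f₁ ∈ LA g B, ∃ f₂ ∈ LA g B, ι x (T f) = T f₁ + f₂)
    {f : Pre g B} (hf : f ∈ LA g B) : T f ∈ LA g B := by
  refine le_LA (LA g B ⊔ (LA g B).map T) ?_ ?_ (Submodule.mem_sup_right ⟨f, hf, rfl⟩)
  · refine sup_le LA_le_HLA ?_
    rintro _ ⟨h, hh, rfl⟩
    exact hT h hh
  · intro x k hk
    obtain ⟨k₁, hk₁, _, ⟨k₂, hk₂, rfl⟩, rfl⟩ := Submodule.mem_sup.1 hk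
    obtain ⟨f₁, h₁, f₂, h₂, e⟩ := hι x k₂ hk₂
    rw [map_add, e, add_comm (T f₁), ← add_assoc]
    exact Submodule.add_mem_sup (add_mem (ι_mem_LA x hk₁) h₂) ⟨f₁, h₁, rfl⟩

theorem ε_mem_LA {f : Pre g B} (hf : f ∈ LA g B) : ε f ∈ LA g B := by
  refine map_mem_LA ε (fun f hf => ⟨fun c x y z h1 h2 h3 => ?_, fun x y => ?_⟩)
    (fun x f hf => ⟨-ι x f, neg_mem (ι_mem_LA x hf), 0, zero_mem _, by simp [ι_ε]⟩) hf
  · simp only [ι_ε, (LA_le_HLA hf).1 c x y z h1 h2 h3, map_add, map_smul]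
    module
  · simp only [ι_ε, map_neg, (LA_le_HLA hf).2 x y, map_smul]
    module

theorem tw_mem_LA (i : ZMod 2) {f : Pre g B} (hf : f ∈ LA g B) : tw i f ∈ LA g B := by
  refine map_mem_LA (tw i) (fun f hf => ⟨fun c x y z h1 h2 h3 => ?_, fun x y => ?_⟩)
    (fun x f hf => ⟨sgn (i * x.par) • ι x f, Submodule.smul_mem _ _ (ι_mem_LA x hf), 0,
      zero_mem _, by simp [ι_tw]⟩) hf
  · simp only [ι_tw, (LA_le_HLA hf).1 c x y z h1 h2 h3, map_add, map_smul, h1, h2]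
    module
  · simp only [ι_tw, map_neg, (LA_le_HLA hf).2 x y, map_smul]
    module

theorem mul_mem_LA {f h : Pre g B} (hf : f ∈ LA g B) (hh : h ∈ LA g B) : f * h ∈ LA g B := by
  refine le_LA (LA g B * LA g B) (Submodule.mul_le.2 fun f hf h hh => ⟨fun c x y z h1 h2 h3 => ?_,
    fun x y => ?_⟩) (fun x k hk => ?_) (Submodule.mul_mem_mul hf hh)
  · simp only [ι_mul, (LA_le_HLA hf).1 c x y z h1 h2 h3, (LA_le_HLA hh).1 c x y z h1 h2 h3, h1, h2,
      add_mul, mul_add, smul_mul_assoc, mul_smul_comm]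
    module
  · simp only [ι_mul, map_add, ι_ε, ι_tw, tw_tw, (LA_le_HLA hf).2 x y, (LA_le_HLA hh).2 x y,
      add_comm y.par x.par, ε_ε, mul_comm y.par x.par, neg_mul, mul_neg,
      smul_mul_assoc, mul_smul_comm]
    rcases sgn_cases (x.par * y.par) with h | h <;> rw [h] <;> module
  · induction hk using Submodule.mul_induction_on' with
    | mem_mul_mem f hf h hh =>
      rw [ι_mul]
      exact add_mem (Submodule.mul_mem_mul (ι_mem_LA x hf) (tw_mem_LA _ hh))
        (Submodule.mul_mem_mul (ε_mem_LA hf) (ι_mem_LA x hh))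
    | add f _ h _ h1 h2 => rw [map_add]; exact add_mem h1 h2

theorem br_right_lin {c : ℂ} {w x y z : Homog g} (h : x.val = c • y.val + z.val) :
    (w.br x).val = c • (w.br y).val + (w.br z).val := by
  simp [Homog.br, h]

theorem br_left_lin {c : ℂ} {w x y z : Homog g} (h : x.val = c • y.val + z.val) :
    (x.br w).val = c • (y.br w).val + (z.br w).val := by
  simp [Homog.br, h]

theorem L_mem_LA (w : Homog g) {f : Pre g B} (hf : f ∈ LA g B) : L w f ∈ LA g B := by
  refine map_mem_LA (L w) (fun f hf => ⟨fun c x y z h1 h2 h3 => ?_, fun x y => ?_⟩)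
    (fun x f hf => ⟨sgn (w.par * x.par) • ι x f, Submodule.smul_mem _ _ (ι_mem_LA x hf),
      -ι (w.br x) f, neg_mem (ι_mem_LA _ hf), by rw [ι_L, map_smul, sub_eq_add_neg]⟩) hf
  · rw [ι_L, ι_L, ι_L, (LA_le_HLA hf).1 c x y z h1 h2 h3,
      (LA_le_HLA hf).1 c (w.br x) (w.br y) (w.br z) (by simp [Homog.br, h1])
      (by simp [Homog.br, h2]) (br_right_lin h3), h1, h2, map_add, map_smul]
    module
  · have hx : (w.br x).par = w.par + x.par := rfl
    have hy : (w.br y).par = w.par + y.par := rfl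
    simp only [ι_L, map_sub, map_smul, (LA_le_HLA hf).2 x y, (LA_le_HLA hf).2 (w.br x) y,
      (LA_le_HLA hf).2 x (w.br y), hx, hy, map_neg, add_mul, mul_add, sgn_add, mul_comm x.par w.par]
    rcases sgn_cases (x.par * y.par) with h | h <;> rcases sgn_cases (w.par * y.par) with h' | h' <;>
      rcases sgn_cases (w.par * x.par) with h'' | h'' <;> rw [h, h', h''] <;> module

theorem L_lin {f : Pre g B} (hf : f ∈ LA g B) {c : ℂ} {x y z : Homog g} (h1 : y.par = x.par)
    (h2 : z.par = x.par) (h3 : x.val = c • y.val + z.val) : L x f = c • L y f + L z f := by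
  funext l
  induction l generalizing f with
  | nil => simp [L_nil, h1, h2, GSuperalgebra.act_lin c x y z h1 h2 h3]
  | cons w l ih =>
    have e (k : Pre g B) : k (w :: l) = ι w k l := rfl
    simp only [add_apply, smul_apply] at ih
    simp only [e, add_apply, smul_apply, map_add, map_smul, ι_L, sub_apply, ih (ι_mem_LA w hf),
      (LA_le_HLA hf).1 c (x.br w) (y.br w) (z.br w) (by simp [Homog.br, h1])
      (by simp [Homog.br, h2]) (br_left_lin h3), h1, h2]
    module

theorem D_mem_LA {f : Pre g B} (hf : f ∈ LA g B) : D f ∈ LA g B := by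
  refine map_mem_LA D (fun f hf => ⟨fun c x y z h1 h2 h3 => ?_, fun x y => ?_⟩)
    (fun x f hf => ⟨-ι x f, neg_mem (ι_mem_LA x hf), L x f, L_mem_LA x hf, by
      rw [ι_D, map_neg]; abel⟩) hf
  · rw [ι_D, ι_D, ι_D, (LA_le_HLA hf).1 c x y z h1 h2 h3, L_lin hf h1 h2 h3, map_add, map_smul]
    module
  · have hs : ι (y.br x) f = -(sgn (x.par * y.par)) • ι (x.br y) f := by
      have h0 : (⟨x.par + y.par, 0, zero_mem _⟩ : Homog g).val = 0 := rfl
      have hz := (LA_le_HLA hf).1 1 ⟨x.par + y.par, 0, zero_mem _⟩ ⟨x.par + y.par, 0, zero_mem _⟩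
        ⟨x.par + y.par, 0, zero_mem _⟩ rfl rfl (by simp)
      rw [(LA_le_HLA hf).1 (-(sgn (x.par * y.par))) (y.br x) (x.br y) ⟨x.par + y.par, 0, zero_mem _⟩
        (add_comm _ _) (add_comm _ _) ?_]
      · rw [one_smul, left_eq_add] at hz
        rw [hz]; module
      · have := skew y.mem x.mem
        simp only [Homog.br, add_zero, neg_smul]
        rw [mul_comm x.par]
        exact eq_neg_of_add_eq_zero_left this
    simp only [ι_D, map_sub, ι_L, (LA_le_HLA hf).2 x y, hs, mul_comm y.par x.par, map_neg, map_smul]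
    rcases sgn_cases (x.par * y.par) with h | h <;> rw [h] <;> module

theorem L_br {f : Pre g B} (hf : f ∈ LA g B) (x y : Homog g) :
    L (x.br y) f = sgn (x.par * y.par) • L x (L y f) - L y (L x f) := by
  funext l
  induction l generalizing f with
  | nil =>
    have h : (x.br y).par = x.par + y.par := rfl
    simp only [L_nil, sub_apply, smul_apply, h, GSuperalgebra.act_br, twB_act, twB_twB, map_smul,
      add_comm y.par x.par, mul_comm y.par x.par]
    rcases sgn_cases (x.par * y.par) with h | h <;> rw [h] <;> module
  | cons w l ih =>
    have e (k : Pre g B) : k (w :: l) = ι w k l := rfl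
    have h : (x.br y).par = x.par + y.par := rfl
    have hx : (x.br w).par = x.par + w.par := rfl
    have hy : (y.br w).par = y.par + w.par := rfl
    have hJ := (LA_le_HLA hf).1 (-(sgn (x.par * y.par))) ((x.br y).br w) (y.br (x.br w))
      (x.br (y.br w)) (by simp only [Homog.br]; abel) (by simp only [Homog.br]; abel) (by
        simp only [Homog.br]
        rw [jacobi (x := x.val) (y := y.val) x.mem y.mem]
        module)
    simp only [e, ι_L, map_sub, map_smul, sub_apply, smul_apply, ih (ι_mem_LA w hf), h, hx, hy, hJ,
      add_mul, mul_add, sgn_add, mul_comm y.par x.par, add_apply]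
    rcases sgn_cases (x.par * y.par) with h | h <;> rcases sgn_cases (x.par * w.par) with h' | h' <;>
      rcases sgn_cases (y.par * w.par) with h'' | h'' <;> rw [h, h', h''] <;> module

theorem L_D {f : Pre g B} (hf : f ∈ LA g B) (x : Homog g) : L x (D f) = D (L x f) := by
  funext l
  induction l generalizing f with
  | nil => simp [L_nil, D_nil]
  | cons w l ih =>
    have e (k : Pre g B) : k (w :: l) = ι w k l := rfl
    simp only [e, ι_L, ι_D, map_sub, map_smul, sub_apply, smul_apply, ih (ι_mem_LA w hf),
      L_br hf x w]
    module

theorem D_D {f : Pre g B} (hf : f ∈ LA g B) : D (D f) = 0 := by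
  funext l
  induction l generalizing f with
  | nil => simp [D_nil]
  | cons w l ih =>
    have e (k : Pre g B) : k (w :: l) = ι w k l := rfl
    simp only [e, ι_D, map_sub, sub_apply, ih (ι_mem_LA w hf), L_D hf]
    simp

/-- The coboundary of Lie superalgebra cohomology: with words indexed from `0`,
`d f (w₀, …, wₙ) = ∑ᵢ (-1)^(i + w̄ᵢ (w̄₀ + ⋯ + w̄ᵢ₋₁ + f̄)) wᵢ.f(w₀, …, ŵᵢ, …, wₙ)
  + ∑_{i < j} (-1)^(i + j + w̄ᵢ w̄ⱼ + w̄ᵢ (w̄₀ + ⋯ + w̄ᵢ₋₁) + w̄ⱼ (w̄₀ + ⋯ + w̄ⱼ₋₁))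
      f([wᵢ, wⱼ], w₀, …, ŵᵢ, …, ŵⱼ, …, wₙ)`. -/
def d (f : Pre g B) : Pre g B := fun l =>
  ∑ i : Fin l.length, ((-1 : ℂ) ^ (i : ℕ) * sgn (l[i].par * parity (l.take i))) •
      GSuperalgebra.act l[i] (tw l[i].par f (l.eraseIdx i)) +
    ∑ i : Fin l.length, ∑ j : Fin l.length,
      if i < j then
        ((-1 : ℂ) ^ (i + j : ℕ) * sgn (l[i].par * l[j].par + l[i].par * parity (l.take i) +
          l[j].par * parity (l.take j))) • f (l[i].br l[j] :: (l.eraseIdx j).eraseIdx i)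
      else 0

theorem move {f : Pre g B} (hf : f ∈ LA g B) (y : Homog g) (l : List (Homog g))
    (j : Fin l.length) : f (l.set j y) =
      ((-1 : ℂ) ^ (j : ℕ) * sgn (y.par * parity (l.take j))) • f (y :: l.eraseIdx j) := by
  induction l generalizing f with
  | nil => exact j.elim0
  | cons w l ih =>
    refine Fin.cases ?_ (fun j => ?_) j
    · simp [parity]
    · have h := ih (ι_mem_LA w hf) j
      have h2 := hf.2 [] (l.eraseIdx j) w y
      simp only [ι_apply, List.nil_append] at h h2
      simp only [Fin.val_succ, List.set_cons_succ, List.take_succ_cons, List.eraseIdx_cons_succ]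
      rw [h, h2]
      simp only [parity, List.map_cons, List.sum_cons, mul_add, sgn_add, pow_succ,
        mul_comm w.par y.par]
      module

theorem sum_cons {α : Type*} (x : α) (l : List α) (F : Fin (x :: l).length → B) :
    ∑ i, F i = F ⟨0, Nat.succ_pos _⟩ +
      ∑ i : Fin l.length, F ⟨i.1 + 1, Nat.succ_lt_succ i.2⟩ :=
  Fin.sum_univ_succ F

theorem d_eq_D {f : Pre g B} (hf : f ∈ LA g B) : d f = D f := by
  funext l
  induction l generalizing f with
  | nil => simp [d, D_nil]
  | cons x l ih =>
    have e (k : Pre g B) : k (x :: l) = ι x k l := rfl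
    rw [e (D f), ι_D, sub_apply, ← ih (ι_mem_LA x hf)]
    change _ = lie x f l - _
    have htw (i : ZMod 2) (k : List (Homog g)) :
        tw i f (x :: k) = sgn (i * x.par) • tw i (ι x f) k := congrFun (ι_tw x i f) k
    have hsw (y : Homog g) (k : List (Homog g)) :
      f (y :: x :: k) = -(sgn (y.par * x.par) • ι x f (y :: k)) := hf.2 [] k y x
    simp only [d, lie]
    simp only [sum_cons, List.getElem_cons_zero, List.getElem_cons_succ, List.take_zero,
      List.take_succ_cons, List.eraseIdx_cons_succ, List.eraseIdx_cons_zero, Fin.getElem_fin, htw,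
      Fin.mk_lt_mk, Nat.not_lt_zero, if_false, lt_self_iff_false, Nat.succ_pos, if_true, hsw,
      Nat.add_lt_add_iff_right, Fin.val_fin_lt, zero_add, pow_zero, map_smul]
    have hp : parity (g := g) [] = 0 := rfl
    have hc (k : List (Homog g)) : parity (x :: k) = x.par + parity k := by simp [parity]
    have hbr (y z : Homog g) : (y.br z).par = y.par + z.par := rfl
    have hmv (j : Fin l.length) := move hf (x.br l[j]) l j
    simp only [Fin.getElem_fin] at hmv
    simp only [hmv, hp, hc, hbr, mul_zero, add_zero, sgn_zero, mul_one, one_smul]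
    rw [sub_eq_add_neg, sub_eq_add_neg, neg_add, ← Finset.sum_neg_distrib, ← Finset.sum_neg_distrib,
      ← Finset.sum_neg_distrib]
    simp only [← Finset.sum_neg_distrib]
    rw [add_assoc, add_assoc, add_left_comm (Finset.sum _ _) (Finset.sum _ _)]
    congr 2
    · refine Finset.sum_congr rfl fun j _ => ?_
      simp only [mul_add, add_mul, sgn_add, pow_succ, mul_comm (l[(j : ℕ)].par) x.par, smul_smul]
      rcases sgn_cases (x.par * l[(j : ℕ)].par) with h | h <;>
        rcases sgn_cases (x.par * parity (l.take j)) with h' | h' <;> rw [h, h'] <;> module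
    · congr 1
      · refine Finset.sum_congr rfl fun j _ => ?_
        simp only [mul_add, sgn_add, pow_succ, mul_comm (l[(j : ℕ)].par) x.par, smul_smul]
        rcases sgn_cases (x.par * l[(j : ℕ)].par) with h | h <;> rw [h] <;> module
      · refine Finset.sum_congr rfl fun i _ => Finset.sum_congr rfl fun j _ => ?_
        split_ifs
        · simp only [mul_add, add_mul, sgn_add, pow_succ, pow_add, smul_neg, smul_smul,
            mul_comm (l[(j : ℕ)].par) x.par, mul_comm (l[(i : ℕ)].par) x.par]
          rcases sgn_cases (x.par * l[(j : ℕ)].par) with h | h <;>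
            rcases sgn_cases (x.par * l[(i : ℕ)].par) with h' | h' <;> rw [h, h'] <;> module
        · simp

/-- Extension of scalars along the unit map `ℂ → B`. -/
def coeff (f : Pre g ℂ) : Pre g B := fun l => algebraMap ℂ B (f l)

end

end Pre

open Pre

/-- A Lie subalgebra of the even part of `g`. -/
structure EvenSubalgebra (g : Type u) [AddCommGroup g] [Module ℂ g] [LieSuperalgebra g] where
  carrier : Submodule ℂ g
  le_even : carrier ≤ part 0
  bracket_mem : ∀ {x y : g}, x ∈ carrier → y ∈ carrier → bracket x y ∈ carrier

/-- The even part `g₀`, as a subalgebra of `g`. -/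
def evenPart (g : Type u) [AddCommGroup g] [Module ℂ g] [LieSuperalgebra g] : EvenSubalgebra g where
  carrier := part 0
  le_even := le_rfl
  bracket_mem hx hy := by simpa using LieSuperalgebra.bracket_mem hx hy

/-- The trivial `g`-module `ℂ`, purely even. -/
instance (g : Type u) [AddCommGroup g] [Module ℂ g] [LieSuperalgebra g] : GSuperalgebra g ℂ where
  σ := AlgHom.id ℂ ℂ
  σ_σ _ := rfl
  act _ := 0
  act_lin := by simp
  σ_act := by simp
  act_mul := by simp
  act_br := by simp

section
variable {g : Type u} [AddCommGroup g] [Module ℂ g] [LieSuperalgebra g]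

section
variable (a : EvenSubalgebra g) {B : Type v} [Ring B] [Algebra ℂ B] [GSuperalgebra g B]

/-- Relative cochains: `f` is an element of `⨁ₙ Cⁿ(g, a; B)` with
`Cⁿ(g, a; B) = Hom_a(Λⁿ(g / a), B)`, where `Λⁿ` is the superexterior power.  The component of `f` in
degree `n` is its restriction to words of length `n`: it is multilinear and super-alternating, vanishes
when an argument is in `a`, commutes with the action of `a`, and is zero for almost all `n`. -/
structure IsCochain (f : Pre g B) : Prop where
  lin : Lin f
  alt : Alt f
  vanish : ∀ x : Homog g, x.par = 0 → x.val ∈ a.carrier → ∀ l, f (x :: l) = 0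
  invariant : ∀ x : Homog g, x.par = 0 → x.val ∈ a.carrier → lie x f = 0
  bounded : ∃ n : ℕ, ∀ l, n ≤ l.length → f l = 0

variable {a}

theorem IsCochain.mem_LA {f : Pre g B} (hf : IsCochain a f) : f ∈ LA g B := ⟨hf.lin, hf.alt⟩

theorem IsCochain.ι_eq {f : Pre g B} (hf : IsCochain a f) {x : Homog g} (h : x.par = 0)
    (h' : x.val ∈ a.carrier) : ι x f = 0 := funext (hf.vanish x h h')

theorem IsCochain.L_eq {f : Pre g B} (hf : IsCochain a f) {x : Homog g} (h : x.par = 0)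
    (h' : x.val ∈ a.carrier) : L x f = 0 := hf.invariant x h h'

theorem mul_bounded (l : List (Homog g)) : ∀ (n m : ℕ) (f h : Pre g B),
    (∀ l, n ≤ l.length → f l = 0) → (∀ l, m ≤ l.length → h l = 0) → n + m ≤ l.length + 1 →
    (f * h) l = 0 := by
  induction l with
  | nil =>
    intro n m f h hf hh hl
    rw [mul_nil]
    rcases Nat.eq_zero_or_pos n with rfl | hn
    · rw [hf [] (by simp), zero_mul]
    · have : m = 0 := by simp at hl; omega
      subst this
      rw [hh [] (by simp), mul_zero]
  | cons x l ih =>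
    intro n m f h hf hh hl
    simp only [List.length_cons] at hl
    rcases Nat.eq_zero_or_pos n with rfl | hn
    · have : f = 0 := funext fun k => hf k (Nat.zero_le _)
      rw [this, zero_mul, Pre.zero_apply]
    rcases Nat.eq_zero_or_pos m with rfl | hm
    · have : h = 0 := funext fun k => hh k (Nat.zero_le _)
      rw [this, mul_zero, Pre.zero_apply]
    rw [mul_cons, ih (n - 1) m (ι x f) (tw x.par h) (fun k hk => hf (x :: k) (by simp; omega))
        (fun k hk => by rw [tw_apply, hh k hk]; simp) (by omega),
      ih n (m - 1) (ε f) (ι x h) (fun k hk => by rw [ε_apply, hf k hk]; simp)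
        (fun k hk => hh (x :: k) (by simp; omega)) (by omega), add_zero]

theorem D_bounded (l : List (Homog g)) : ∀ (n : ℕ) (f : Pre g B),
    (∀ l, n ≤ l.length → f l = 0) → n + 1 ≤ l.length → D f l = 0 := by
  induction l with
  | nil => intros; rfl
  | cons x l ih =>
    intro n f hf hl
    simp only [List.length_cons] at hl
    change L x f l - D (ι x f) l = 0
    have h0 : D (ι x f) l = 0 := by
      rcases Nat.eq_zero_or_pos n with rfl | hn
      · have : f = 0 := funext fun k => hf k (Nat.zero_le _)
        rw [this, map_zero, map_zero, Pre.zero_apply]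
      · exact ih (n - 1) (ι x f) (fun k hk => hf (x :: k) (by simp; omega)) (by omega)
    rw [h0]
    change lie x f l - 0 = 0
    simp only [lie, tw_apply]
    rw [hf l (by omega)]
    simp only [map_zero, smul_zero, sub_zero, zero_sub, neg_eq_zero]
    refine Finset.sum_eq_zero fun j _ => ?_
    rw [hf _ (by simp; omega), smul_zero]

theorem IsCochain.d_eq {f : Pre g B} (hf : IsCochain a f) : d f = D f := d_eq_D hf.mem_LA

theorem IsCochain.d {f : Pre g B} (hf : IsCochain a f) : IsCochain a (d f) where
  lin := by rw [hf.d_eq]; exact (D_mem_LA hf.mem_LA).1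
  alt := by rw [hf.d_eq]; exact (D_mem_LA hf.mem_LA).2
  vanish x h h' l := by
    rw [hf.d_eq]
    change ι x (D f) l = 0
    rw [ι_D, hf.L_eq h h', hf.ι_eq h h']
    simp
  invariant x h h' := by
    rw [hf.d_eq]
    change L x (D f) = 0
    rw [L_D hf.mem_LA, hf.L_eq h h', map_zero]
  bounded := by
    obtain ⟨n, hn⟩ := hf.bounded
    exact ⟨n + 1, fun l hl => by rw [hf.d_eq]; exact D_bounded l n f hn hl⟩

theorem IsCochain.d_d {f : Pre g B} (hf : IsCochain a f) : Pre.d (Pre.d f) = 0 := by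
  rw [hf.d.d_eq, hf.d_eq, D_D hf.mem_LA]

theorem IsCochain.mul {f h : Pre g B} (hf : IsCochain a f) (hh : IsCochain a h) :
    IsCochain a (f * h) where
  lin := (mul_mem_LA hf.mem_LA hh.mem_LA).1
  alt := (mul_mem_LA hf.mem_LA hh.mem_LA).2
  vanish x h1 h2 l := by
    change ι x (f * h) l = 0
    rw [ι_mul, hf.ι_eq h1 h2, hh.ι_eq h1 h2]
    simp
  invariant x h1 h2 := by
    change L x (f * h) = 0
    rw [Pre.L_mul, hf.L_eq h1 h2, hh.L_eq h1 h2]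
    simp
  bounded := by
    obtain ⟨n, hn⟩ := hf.bounded
    obtain ⟨m, hm⟩ := hh.bounded
    exact ⟨n + m, fun l hl => mul_bounded l n m f h hn hm (by omega)⟩

theorem IsCochain.add {f h : Pre g B} (hf : IsCochain a f) (hh : IsCochain a h) :
    IsCochain a (f + h) where
  lin := (add_mem hf.mem_LA hh.mem_LA).1
  alt := (add_mem hf.mem_LA hh.mem_LA).2
  vanish x h1 h2 l := by rw [Pre.add_apply, hf.vanish x h1 h2, hh.vanish x h1 h2, add_zero]
  invariant x h1 h2 := by
    change L x (f + h) = 0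
    rw [map_add, hf.L_eq h1 h2, hh.L_eq h1 h2, add_zero]
  bounded := by
    obtain ⟨n, hn⟩ := hf.bounded
    obtain ⟨m, hm⟩ := hh.bounded
    exact ⟨n + m, fun l hl => by
      rw [Pre.add_apply, hn l (by omega), hm l (by omega), add_zero]⟩

theorem act_one (x : Homog g) : GSuperalgebra.act x (1 : B) = 0 := by
  have h := act_mul x (1 : B) 1
  simpa using h

theorem L_one (x : Homog g) : L x (1 : Pre g B) = 0 := by
  have h := Pre.L_mul x (1 : Pre g B) 1
  simpa [tw_one] using h

theorem D_one : D (1 : Pre g B) = 0 := by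
  have h := D_mul (1 : Pre g B) 1
  simpa [ε_one] using h

theorem IsCochain.one : IsCochain a (1 : Pre g B) := by
  have h : (1 : Pre g B) ∈ LA g B := by
    refine le_LA (ℂ ∙ 1) ?_ ?_ (Submodule.mem_span_singleton_self _)
    · rw [Submodule.span_singleton_le_iff_mem]
      exact ⟨fun c x y z _ _ _ => by simp [ι_one], fun x y => by simp [ι_one]⟩
    · intro x f hf
      obtain ⟨c, rfl⟩ := Submodule.mem_span_singleton.1 hf
      simp [ι_one]
  refine ⟨h.1, h.2, fun x _ _ l => congrFun (ι_one x) l, fun x _ _ => L_one x, 1, fun l hl => ?_⟩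
  cases l with
  | nil => simp at hl
  | cons x l => exact congrFun (ι_one x) l

theorem IsCochain.smul (c : ℂ) {f : Pre g B} (hf : IsCochain a f) : IsCochain a (c • f) where
  lin := (Submodule.smul_mem _ c hf.mem_LA).1
  alt := (Submodule.smul_mem _ c hf.mem_LA).2
  vanish x h1 h2 l := by rw [Pre.smul_apply, hf.vanish x h1 h2, smul_zero]
  invariant x h1 h2 := by
    change L x (c • f) = 0
    rw [map_smul, hf.L_eq h1 h2, smul_zero]
  bounded := by
    obtain ⟨n, hn⟩ := hf.bounded
    exact ⟨n, fun l hl => by rw [Pre.smul_apply, hn l hl, smul_zero]⟩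

theorem IsCochain.ε {f : Pre g B} (hf : IsCochain a f) : IsCochain a (ε f) where
  lin := (ε_mem_LA hf.mem_LA).1
  alt := (ε_mem_LA hf.mem_LA).2
  vanish x h1 h2 l := by rw [ε_apply, hf.vanish x h1 h2, smul_zero]
  invariant x h1 h2 := by
    change L x (Pre.ε f) = 0
    rw [L_ε, hf.L_eq h1 h2, map_zero]
  bounded := by
    obtain ⟨n, hn⟩ := hf.bounded
    exact ⟨n, fun l hl => by rw [ε_apply, hn l hl, smul_zero]⟩

theorem algebraMap_eq_smul (c : ℂ) : algebraMap ℂ (Pre g B) c = c • 1 :=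
  Algebra.algebraMap_eq_smul_one c

variable (a B)

/-- The algebra of relative cocycles, under the cup product. -/
def cocycles : Subalgebra ℂ (Pre g B) where
  carrier := {f | IsCochain a f ∧ d f = 0}
  mul_mem' := by
    rintro f h ⟨hf, hf'⟩ ⟨hh, hh'⟩
    refine ⟨hf.mul hh, ?_⟩
    rw [(hf.mul hh).d_eq, D_mul, ← hf.d_eq, ← hh.d_eq, hf', hh']
    simp
  add_mem' := by
    rintro f h ⟨hf, hf'⟩ ⟨hh, hh'⟩
    refine ⟨hf.add hh, ?_⟩
    rw [(hf.add hh).d_eq, map_add, ← hf.d_eq, ← hh.d_eq, hf', hh', add_zero]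
  algebraMap_mem' c := by
    rw [algebraMap_eq_smul]
    refine ⟨(IsCochain.one (a := a)).smul c, ?_⟩
    rw [((IsCochain.one (a := a)).smul c).d_eq, map_smul, D_one, smul_zero]

/-- The ideal of relative coboundaries. -/
def coboundaries : Ideal (cocycles a B) where
  carrier := {z | ∃ f : Pre g B, IsCochain a f ∧ d f = z}
  zero_mem' := ⟨(0 : ℂ) • 1, (IsCochain.one (a := a)).smul 0, by
    rw [((IsCochain.one (a := a)).smul 0).d_eq]; simp⟩
  add_mem' := by
    rintro _ _ ⟨f, hf, e⟩ ⟨h, hh, e'⟩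
    refine ⟨f + h, hf.add hh, ?_⟩
    rw [(hf.add hh).d_eq, map_add, ← hf.d_eq, ← hh.d_eq, e, e']
    rfl
  smul_mem' := by
    rintro z _ ⟨f, hf, e⟩
    refine ⟨ε z * f, z.2.1.ε.mul hf, ?_⟩
    rw [(z.2.1.ε.mul hf).d_eq, D_mul, D_ε, ← hf.d_eq, ← z.2.1.d_eq, z.2.2, e]
    simp

instance : (coboundaries a B).IsTwoSided where
  mul_mem_of_left := by
    rintro _ z ⟨f, hf, e⟩
    refine ⟨f * z, hf.mul z.2.1, ?_⟩
    rw [(hf.mul z.2.1).d_eq, D_mul, ← hf.d_eq, ← z.2.1.d_eq, z.2.2, e]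
    simp

/-- The relative cohomology ring `H^•(g, a; B) = ⨁ₙ Hⁿ(g, a; B)`: cocycles modulo coboundaries. -/
abbrev Cohomology : Type _ := cocycles a B ⧸ coboundaries a B

/-- The cocycles that are concentrated in even degrees. -/
def evenCocycles : Subalgebra ℂ (cocycles a ℂ) where
  carrier := {z | ∀ l, Odd l.length → (z : Pre g ℂ) l = 0}
  mul_mem' := by
    have key (z : Pre g ℂ) : (∀ l, Odd l.length → z l = 0) ↔ ε z = z := by
      refine ⟨fun h => funext fun l => ?_, fun h l hl => ?_⟩
      · rcases Nat.even_or_odd l.length with hl | hl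
        · simp [ε_apply, hl.neg_one_pow]
        · simp [ε_apply, h l hl]
      · have := congrFun h l
        simp only [ε_apply, hl.neg_one_pow, neg_smul, one_smul] at this
        exact self_eq_neg.1 this.symm
    intro f h hf hh
    refine (key _).2 ?_
    change ε ((f : Pre g ℂ) * (h : Pre g ℂ)) = _
    rw [ε_mul, (key _).1 hf, (key _).1 hh]
    rfl
  add_mem' := by
    intro f h hf hh l hl
    change (f : Pre g ℂ) l + (h : Pre g ℂ) l = 0
    rw [hf l hl, hh l hl, add_zero]
  algebraMap_mem' c l hl := by
    change algebraMap ℂ (Pre g ℂ) c l = 0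
    rw [algebraMap_eq_smul, Pre.smul_apply]
    cases l with
    | nil => simp at hl
    | cons x l => simp [show (1 : Pre g ℂ) (x :: l) = 0 from congrFun (ι_one x) l]

/-- The ring `H^{ev}(g, a; ℂ) = ⨁ₙ H²ⁿ(g, a; ℂ)` of even cohomology classes. -/
def Hev : Subalgebra ℂ (Cohomology a ℂ) :=
  (evenCocycles a).map (Ideal.Quotient.mkₐ ℂ (coboundaries a ℂ))

theorem coeff_ι (x : Homog g) (f : Pre g ℂ) : ι x (coeff f : Pre g B) = coeff (ι x f) := rfl

variable {a B}

theorem act_algebraMap (x : Homog g) (c : ℂ) : GSuperalgebra.act x (algebraMap ℂ B c) = 0 := by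
  rw [Algebra.algebraMap_eq_smul_one, map_smul, act_one, smul_zero]

theorem tw_coeff (i : ZMod 2) (f : Pre g ℂ) : tw i (coeff f : Pre g B) = coeff (tw i f) := by
  have h (c : ℂ) : twB g i c = c := by
    rcases zmod_two_cases i with rfl | rfl
    · exact twB_zero g c
    · exact twB_one g c
  funext l
  simp [tw_apply, coeff, h, Algebra.smul_def]

theorem ε_coeff (f : Pre g ℂ) : ε (coeff f : Pre g B) = coeff (ε f) := by
  funext l
  simp [ε_apply, coeff, Algebra.smul_def]

theorem coeff_add (f h : Pre g ℂ) : (coeff (f + h) : Pre g B) = coeff f + coeff h := by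
  funext l; simp [coeff]

theorem coeff_smul (c : ℂ) (f : Pre g ℂ) : (coeff (c • f) : Pre g B) = c • coeff f := by
  funext l; simp [coeff, Algebra.smul_def]

theorem coeff_mul (f h : Pre g ℂ) : (coeff (f * h) : Pre g B) = coeff f * coeff h := by
  funext l
  induction l generalizing f h with
  | nil => simp [coeff, mul_nil]
  | cons x l ih =>
    change (coeff (ι x (f * h)) : Pre g B) l = ι x (coeff f * coeff h) l
    rw [ι_mul, ι_mul, coeff_add, Pre.add_apply, Pre.add_apply, ih, ih, tw_coeff, ε_coeff, coeff_ι, coeff_ι]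

theorem coeff_one : (coeff 1 : Pre g B) = 1 :=
  ext_ι (by simp [coeff, one_nil]) fun x => by
    rw [coeff_ι, ι_one, ι_one]; funext l; simp [coeff]

theorem lie_coeff (x : Homog g) (f : Pre g ℂ) : lie x (coeff f : Pre g B) = coeff (lie x f) := by
  funext l
  have h (c : ℂ) : GSuperalgebra.act x c = 0 := rfl
  change GSuperalgebra.act x (tw x.par (coeff f) l) -
    ∑ j : Fin l.length, sgn (x.par * parity (l.take j)) • algebraMap ℂ B (f (l.set j (x.br l[j]))) =
    algebraMap ℂ B (lie x f l)
  rw [tw_coeff, lie, h, zero_sub, map_neg, map_sum]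
  simp only [coeff, act_algebraMap, zero_sub, smul_eq_mul, map_mul, Algebra.smul_def]

theorem D_coeff (f : Pre g ℂ) : D (coeff f : Pre g B) = coeff (D f) := by
  funext l
  induction l generalizing f with
  | nil => simp [coeff, D_nil]
  | cons x l ih =>
    change lie x (coeff f : Pre g B) l - D (ι x (coeff f : Pre g B)) l =
      algebraMap ℂ B (lie x f l - D (ι x f) l)
    rw [lie_coeff, coeff_ι, ih, map_sub]
    rfl

theorem IsCochain.coeff {f : Pre g ℂ} (hf : IsCochain a f) : IsCochain a (coeff f : Pre g B) where
  lin l l' c x y z h1 h2 h3 := by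
    simp only [Pre.coeff, hf.lin l l' c x y z h1 h2 h3, map_add, smul_eq_mul, map_mul,
      Algebra.smul_def]
  alt l l' x y := by
    simp only [Pre.coeff, hf.alt l l' x y, map_neg, smul_eq_mul, map_mul,
      Algebra.smul_def]
  vanish x h1 h2 l := by simp [Pre.coeff, hf.vanish x h1 h2 l]
  invariant x h1 h2 := by
    rw [lie_coeff, hf.invariant x h1 h2]; funext l; simp [Pre.coeff]
  bounded := by
    obtain ⟨n, hn⟩ := hf.bounded
    exact ⟨n, fun l hl => by simp [Pre.coeff, hn l hl]⟩

theorem IsCochain.restrict {f : Pre g B} (hf : IsCochain (evenPart g) f) : IsCochain a f where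
  lin := hf.lin
  alt := hf.alt
  vanish x h1 h2 := hf.vanish x h1 (a.le_even h2)
  invariant x h1 h2 := hf.invariant x h1 (a.le_even h2)
  bounded := hf.bounded

variable (a B)

/-- Extension of coefficients `ℂ → B` on cocycles. -/
def cocyclesCoeff : cocycles a ℂ →+* cocycles a B where
  toFun z := ⟨coeff z, z.2.1.coeff, by
    rw [z.2.1.coeff.d_eq, D_coeff, ← z.2.1.d_eq, z.2.2]; funext l; simp [coeff]⟩
  map_one' := Subtype.ext coeff_one
  map_mul' z w := Subtype.ext (coeff_mul _ _)
  map_zero' := Subtype.ext (by funext l; simp [coeff])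
  map_add' z w := Subtype.ext (coeff_add _ _)

/-- The ring homomorphism `H^•(g, a; ℂ) → H^•(g, a; B)` induced by the unit map `ℂ → B`. -/
def cohomologyCoeff : Cohomology a ℂ →+* Cohomology a B :=
  Ideal.Quotient.lift (coboundaries a ℂ)
    ((Ideal.Quotient.mk (coboundaries a B)).comp (cocyclesCoeff a B)) (by
      rintro z ⟨f, hf, e⟩
      refine Ideal.Quotient.eq_zero_iff_mem.2 ⟨coeff f, hf.coeff, ?_⟩
      rw [hf.coeff.d_eq, D_coeff, ← hf.d_eq, e]
      rfl)

/-- Restriction of cocycles: a cocycle relative to `g₀` is a cocycle relative to `a`. -/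
def cocyclesRes : cocycles (evenPart g) ℂ →+* cocycles a ℂ where
  toFun z := ⟨z, z.2.1.restrict, z.2.2⟩
  map_one' := rfl
  map_mul' _ _ := rfl
  map_zero' := rfl
  map_add' _ _ := rfl

/-- The restriction homomorphism `H^•(g, g₀; ℂ) → H^•(g, a; ℂ)`. -/
def res : Cohomology (evenPart g) ℂ →+* Cohomology a ℂ :=
  Ideal.Quotient.lift (coboundaries (evenPart g) ℂ)
    ((Ideal.Quotient.mk (coboundaries a ℂ)).comp (cocyclesRes a)) (by
      rintro z ⟨f, hf, e⟩
      exact Ideal.Quotient.eq_zero_iff_mem.2 ⟨f, hf.restrict, e⟩)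

/-- The restriction homomorphism `H^{ev}(g, g₀; ℂ) → H^{ev}(g, a; ℂ)`. -/
def resEv : Hev (evenPart g) →+* Hev a :=
  ((res a).comp (Hev (evenPart g)).val.toRingHom).codRestrict (Hev a) (by
    rintro ⟨_, z, hz, rfl⟩
    exact ⟨cocyclesRes a z, hz, rfl⟩)

end
end

/-- A field extension of `ℂ` of countable dimension is trivial. -/
theorem exists_algebraMap_eq {K : Type v} [Field K] [Algebra ℂ K]
    (hK : Module.rank ℂ K ≤ Cardinal.aleph0) (x : K) : ∃ c : ℂ, algebraMap ℂ K c = x := by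
  have halg : Algebra.IsAlgebraic ℂ K := by
    refine ⟨fun x => ?_⟩
    by_contra hx
    have h := (Transcendental.linearIndependent_sub_inv hx).cardinal_lift_le_rank
    have h2 : Cardinal.lift.{v} (Cardinal.mk ℂ) ≤ Cardinal.aleph0 := by
      refine h.trans ?_
      simpa using hK
    rw [Cardinal.lift_le_aleph0, Cardinal.mk_complex] at h2
    exact absurd h2 (not_le.2 Cardinal.aleph0_lt_continuum)
  exact (IsAlgClosed.algebraMap_bijective_of_isIntegral (k := ℂ) (K := K)).2 x

theorem exists_mul_of_notMem {R : Type v} [Ring R] {m : Ideal R} (hm : m.IsMaximal) {r : R}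
    (hr : r ∉ m) : ∃ x ∈ m, ∃ s : R, x + s * r = 1 := by
  have h : (1 : R) ∈ m ⊔ Ideal.span {r} := by
    rw [hm.1.2 (m ⊔ Ideal.span {r})]
    · trivial
    · refine lt_of_le_of_ne le_sup_left fun e => hr ?_
      rw [e]
      exact Submodule.mem_sup_right (Ideal.subset_span rfl)
  obtain ⟨x, hx, y, hy, e⟩ := Submodule.mem_sup.1 h
  obtain ⟨s, rfl⟩ := Ideal.mem_span_singleton'.1 hy
  exact ⟨x, hx, s, e⟩

theorem exists_sub_algebraMap_mem {R : Type v} [Ring R] [Algebra ℂ R]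
    (hR : Module.rank ℂ R ≤ Cardinal.aleph0) (R₁ : Set R)
    (hd : ∀ r : R, ∃ r₀ ∈ Subalgebra.center ℂ R, ∃ r₁ ∈ R₁, r = r₀ + r₁)
    (h0 : ∀ r ∈ R₁, r * r = 0) (hc : ∀ r ∈ R₁, ∀ s : R, ∃ s', r * s = s' * r)
    (m : Ideal R) (hm : m.IsMaximal) (r : R) : ∃ c : ℂ, r - algebraMap ℂ R c ∈ m := by
  have odd_mem : ∀ r ∈ R₁, r ∈ m := by
    intro r hr
    by_contra hrm
    obtain ⟨x, hx, s, e⟩ := exists_mul_of_notMem hm hrm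
    obtain ⟨s', hs'⟩ := hc r hr s
    have h1 : s * r * (s * r) = 0 := by
      rw [mul_assoc, ← mul_assoc r s r, hs', mul_assoc s' r r, h0 r hr, mul_zero, mul_zero]
    have h2 : (1 + s * r) * x = 1 := by
      rw [eq_sub_of_add_eq e]
      calc (1 + s * r) * (1 - s * r) = 1 - s * r * (s * r) := by noncomm_ring
        _ = 1 := by rw [h1, sub_zero]
    exact hm.ne_top ((Ideal.eq_top_iff_one m).2 (h2 ▸ m.mul_mem_left _ hx))
  let Z := Subalgebra.center ℂ R
  let m₀ : Ideal Z := m.comap Z.val.toRingHom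
  have hm₀ (z : Z) : z ∈ m₀ ↔ (z : R) ∈ m := Iff.rfl
  have hmax : m₀.IsMaximal := by
    rw [Ideal.isMaximal_iff]
    refine ⟨fun h => hm.ne_top ((Ideal.eq_top_iff_one m).2 h), fun J z hJ hz hzJ => ?_⟩
    obtain ⟨x, hx, s, e⟩ := exists_mul_of_notMem hm (r := (z : R)) hz
    obtain ⟨s₀, hs₀, s₁, hs₁, rfl⟩ := hd s
    have h1 : (1 - ⟨s₀, hs₀⟩ * z : Z) ∈ m₀ := by
      rw [hm₀]
      change 1 - s₀ * (z : R) ∈ m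
      have h2 : s₁ * (z : R) ∈ m := by
        rw [Subalgebra.mem_center_iff.1 z.2 s₁]
        exact m.mul_mem_left _ (odd_mem s₁ hs₁)
      have h3 : 1 - s₀ * (z : R) = x + s₁ * z := by rw [← e]; noncomm_ring
      rw [h3]
      exact add_mem hx h2
    have h4 := add_mem (hJ h1) (J.mul_mem_left ⟨s₀, hs₀⟩ hzJ)
    rwa [sub_add_cancel] at h4
  let _ : Field (Z ⧸ m₀) := Ideal.Quotient.field m₀
  have hrank : Module.rank ℂ (Z ⧸ m₀) ≤ Cardinal.aleph0 :=
    ((LinearMap.rank_le_of_surjective (Ideal.Quotient.mkₐ ℂ m₀).toLinearMap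
      Ideal.Quotient.mk_surjective).trans (Submodule.rank_le Z.toSubmodule)).trans hR
  obtain ⟨r₀, hr₀, r₁, hr₁, rfl⟩ := hd r
  obtain ⟨c, hc⟩ := exists_algebraMap_eq hrank (Ideal.Quotient.mk m₀ ⟨r₀, hr₀⟩)
  refine ⟨c, ?_⟩
  have : (⟨r₀, hr₀⟩ : Z) - algebraMap ℂ Z c ∈ m₀ := by
    rw [← Ideal.Quotient.eq_zero_iff_mem, map_sub, ← hc]
    exact sub_self _
  have h2 : r₀ - algebraMap ℂ R c ∈ m := this
  rw [add_sub_right_comm]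
  exact add_mem h2 (odd_mem r₁ hr₁)

/-- Contraction of a maximal ideal. -/
theorem comap_isMaximal {R : Type v} {R' : Type v} [Ring R] [Ring R'] [Algebra ℂ R]
    [Algebra ℂ R'] (φ : R' →+* R) (hφ : ∀ c : ℂ, φ (algebraMap ℂ R' c) = algebraMap ℂ R c)
    (m : Ideal R) (hm : m ≠ ⊤) (h : ∀ r : R, ∃ c : ℂ, r - algebraMap ℂ R c ∈ m) :
    (m.comap φ).IsMaximal := by
  rw [Ideal.isMaximal_iff]
  refine ⟨fun h1 => hm ?_, fun J x hJ hx hxJ => ?_⟩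
  · rw [Ideal.eq_top_iff_one]
    simpa using h1
  · obtain ⟨c, hc⟩ := h (φ x)
    have h1 : x - algebraMap ℂ R' c ∈ J := hJ (by rwa [Ideal.mem_comap, map_sub, hφ])
    have hc0 : c ≠ 0 := by
      rintro rfl
      exact hx (by simpa using hc)
    have h2 : algebraMap ℂ R' c ∈ J := by simpa using sub_mem hxJ h1
    have h3 := J.mul_mem_left (algebraMap ℂ R' c⁻¹) h2
    rwa [← map_mul, inv_mul_cancel₀ hc0, map_one] at h3

section maximal
variable {g : Type u} [AddCommGroup g] [Module ℂ g] [LieSuperalgebra g]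

theorem mul_comm_apply (l : List (Homog g)) : ∀ (f h : Pre g ℂ) (m n p q : ZMod 2),
    ε f = sgn m • f → ε h = sgn n • h → (∀ i, tw i f = sgn (i * p) • f) →
    (∀ i, tw i h = sgn (i * q) • h) →
    (f * h) l = sgn (m * n + p * q) • (h * f) l := by
  induction l with
  | nil =>
    intro f h m n p q h1 h2 h3 h4
    rw [mul_nil, mul_nil]
    by_cases hf : f [] = 0
    · simp [hf]
    have e1 := congrFun h1 []
    have e2 := congrFun (h3 1) []
    rw [ε_nil, Pre.smul_apply] at e1
    rw [tw_nil, Pre.smul_apply, twB_one] at e2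
    change f [] = _ at e2
    have hm : m = 0 := by
      rcases zmod_two_cases m with rfl | rfl
      · rfl
      · simp only [sgn_one, neg_smul, one_smul] at e1
        exact absurd (self_eq_neg.1 e1) hf
    have hp : p = 0 := by
      rcases zmod_two_cases p with rfl | rfl
      · rfl
      · simp only [mul_one, sgn_one, neg_smul, one_smul] at e2
        exact absurd (self_eq_neg.1 e2) hf
    subst hm hp
    simp [mul_comm]
  | cons x l ih =>
    intro f h m n p q h1 h2 h3 h4
    have a1 (k : Pre g ℂ) (m : ZMod 2) (hk : ε k = sgn m • k) :
        ε (ι x k) = sgn (m + 1) • ι x k := by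
      have := ι_ε x k
      rw [hk, map_smul] at this
      rw [sgn_add, sgn_one, mul_smul, neg_smul, one_smul, smul_neg, this, neg_neg]
    have a2 (k : Pre g ℂ) (p : ZMod 2) (hk : ∀ i, tw i k = sgn (i * p) • k) (i : ZMod 2) :
        tw i (ι x k) = sgn (i * (p + x.par)) • ι x k := by
      have := ι_tw x i k
      rw [hk, map_smul] at this
      rw [mul_add, sgn_add, mul_comm (sgn _), mul_smul, this, smul_smul, sgn_mul_self, one_smul]
    have b1 := ih (ι x f) h (m + 1) n (p + x.par) q (a1 f m h1) h2 (a2 f p h3) h4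
    have b2 := ih f (ι x h) m (n + 1) p (q + x.par) h1 (a1 h n h2) h3 (a2 h q h4)
    rw [mul_cons, mul_cons, h1, h2, h3, h4]
    simp only [smul_mul_assoc, mul_smul_comm, Pre.smul_apply, b1, b2, add_mul, mul_add, sgn_add,
      one_mul, mul_one]
    rw [mul_comm p x.par]
    rcases sgn_cases (x.par * p) with e | e <;> rcases sgn_cases (x.par * q) with e' | e' <;>
      rcases sgn_cases m with e2 | e2 <;> rcases sgn_cases n with e3 | e3 <;>
      rw [e, e', e2, e3] <;> module

theorem mul_eq_tw_mul {f h : Pre g ℂ} (hf : ε f = f) (hh : ε h = h) (p : ZMod 2)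
    (hp : tw 1 f = sgn p • f) : f * h = tw p h * f := by
  have tw_of (k : Pre g ℂ) (q : ZMod 2) (hk : tw 1 k = sgn q • k) (i : ZMod 2) :
      tw i k = sgn (i * q) • k := by
    rcases zmod_two_cases i with rfl | rfl
    · simp [tw_zero]
    · simpa using hk
  have key (q : ZMod 2) : f * ((1 / 2 : ℂ) • (h + sgn q • tw 1 h)) =
      tw p ((1 / 2 : ℂ) • (h + sgn q • tw 1 h)) * f := by
    have hq : tw 1 ((1 / 2 : ℂ) • (h + sgn q • tw 1 h)) =
        sgn q • ((1 / 2 : ℂ) • (h + sgn q • tw 1 h)) := by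
      have h11 : (1 : ZMod 2) + 1 = 0 := by decide
      simp only [map_smul, map_add, tw_tw, h11, tw_zero]
      rcases sgn_cases q with e | e <;> rw [e] <;> module
    rw [tw_of _ q hq p, smul_mul_assoc]
    funext l
    rw [mul_comm_apply l f _ 0 0 p q (by simpa using hf) (by simp [hh, ← tw_ε]) (tw_of f p hp)
      (tw_of _ q hq)]
    simp
  have hs : h = (1 / 2 : ℂ) • (h + sgn 0 • tw 1 h) + (1 / 2 : ℂ) • (h + sgn 1 • tw 1 h) := by
    simp only [sgn_zero, sgn_one]
    module
  rw [hs, mul_add, key 0, key 1, map_add, add_mul]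

variable {a : EvenSubalgebra g}

theorem IsCochain.tw (i : ZMod 2) {f : Pre g ℂ} (hf : IsCochain a f) : IsCochain a (tw i f) where
  lin := (tw_mem_LA i hf.mem_LA).1
  alt := (tw_mem_LA i hf.mem_LA).2
  vanish x h1 h2 l := by rw [tw_apply, hf.vanish x h1 h2, map_zero, smul_zero]
  invariant x h1 h2 := by
    change L x (Pre.tw i f) = 0
    have h := tw_L i x f
    rw [hf.L_eq h1 h2, map_zero, h1, mul_zero, sgn_zero, one_smul] at h
    exact h.symm
  bounded := by
    obtain ⟨n, hn⟩ := hf.bounded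
    exact ⟨n, fun l hl => by rw [tw_apply, hn l hl, map_zero, smul_zero]⟩

/-- The parity operator on cocycles. -/
def twCocycle (i : ZMod 2) (z : cocycles a ℂ) : cocycles a ℂ :=
  ⟨tw i (z : Pre g ℂ), z.2.1.tw i, by
    rw [(z.2.1.tw i).d_eq, ← tw_D, ← z.2.1.d_eq, z.2.2, map_zero]⟩

theorem mem_evenCocycles {z : cocycles a ℂ} (hz : z ∈ evenCocycles a) :
    ε (z : Pre g ℂ) = z := by
  funext l
  rcases Nat.even_or_odd l.length with hl | hl
  · simp [ε_apply, hl.neg_one_pow]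
  · simp [ε_apply, hz l hl]

theorem twCocycle_mem (i : ZMod 2) {z : cocycles a ℂ} (hz : z ∈ evenCocycles a) :
    twCocycle i z ∈ evenCocycles a := fun l hl => by
  change tw i (z : Pre g ℂ) l = 0
  rw [tw_apply, hz l hl, map_zero, smul_zero]

/-- The class of an even cocycle. -/
def evClass (z : cocycles a ℂ) (hz : z ∈ evenCocycles a) : Hev a :=
  ⟨Ideal.Quotient.mk _ z, z, hz, rfl⟩

variable (a) in
/-- The classes of odd parity in `H^{ev}(g, a; ℂ)`. -/
def oddClasses : Set (Hev a) :=
  {r | ∃ z, ∃ hz : z ∈ evenCocycles a, tw 1 (z : Pre g ℂ) = -z ∧ r = evClass z hz}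

theorem evClass_surj (r : Hev a) : ∃ z, ∃ hz : z ∈ evenCocycles a, r = evClass z hz := by
  obtain ⟨_, z, hz, rfl⟩ := r
  exact ⟨z, hz, rfl⟩

theorem evClass_mul {z w z' w' : cocycles a ℂ} (hz : z ∈ evenCocycles a) (hw : w ∈ evenCocycles a)
    (hz' : z' ∈ evenCocycles a) (hw' : w' ∈ evenCocycles a)
    (h : (z : Pre g ℂ) * (w : Pre g ℂ) = z' * w') :
    evClass z hz * evClass w hw = evClass z' hz' * evClass w' hw' := by
  refine Subtype.ext ?_
  change Ideal.Quotient.mk _ z * Ideal.Quotient.mk _ w =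
    Ideal.Quotient.mk _ z' * Ideal.Quotient.mk _ w'
  rw [← map_mul, ← map_mul]
  exact congrArg _ (Subtype.ext h)

theorem Hev_decomp (r : Hev a) : ∃ r₀ ∈ Subalgebra.center ℂ (Hev a), ∃ r₁ ∈ oddClasses a,
    r = r₀ + r₁ := by
  obtain ⟨z, hz, rfl⟩ := evClass_surj r
  have h11 : (1 : ZMod 2) + 1 = 0 := by decide
  have h0 := (evenCocycles a).smul_mem (add_mem hz (twCocycle_mem 1 hz)) (1 / 2 : ℂ)
  have h1 := (evenCocycles a).smul_mem (sub_mem hz (twCocycle_mem 1 hz)) (1 / 2 : ℂ)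
  refine ⟨evClass _ h0, ?_, evClass _ h1, ⟨_, h1, ?_, rfl⟩, ?_⟩
  · rw [Subalgebra.mem_center_iff]
    intro s
    obtain ⟨w, hw, rfl⟩ := evClass_surj s
    refine (evClass_mul _ _ _ _ ?_).symm
    rw [mul_eq_tw_mul (mem_evenCocycles h0) (mem_evenCocycles hw) 0, tw_zero]
    change tw 1 ((1 / 2 : ℂ) • ((z : Pre g ℂ) + tw 1 (z : Pre g ℂ))) =
      sgn 0 • (1 / 2 : ℂ) • ((z : Pre g ℂ) + tw 1 (z : Pre g ℂ))
    simp only [map_smul, map_add, tw_tw, h11, tw_zero, sgn_zero]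
    module
  · change tw 1 ((1 / 2 : ℂ) • ((z : Pre g ℂ) - tw 1 (z : Pre g ℂ))) =
      -((1 / 2 : ℂ) • ((z : Pre g ℂ) - tw 1 (z : Pre g ℂ)))
    simp only [map_smul, map_sub, tw_tw, h11, tw_zero]
    module
  · refine Subtype.ext ?_
    change Ideal.Quotient.mk _ z = Ideal.Quotient.mk _ _ + Ideal.Quotient.mk _ _
    rw [← map_add]
    congr 1
    module

theorem oddClasses_sq (r : Hev a) (hr : r ∈ oddClasses a) : r * r = 0 := by
  obtain ⟨z, hz, h, rfl⟩ := hr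
  have h1 := mul_eq_tw_mul (mem_evenCocycles hz) (mem_evenCocycles hz) 1 (by simpa using h)
  rw [h, neg_mul] at h1
  have h2 : (z : Pre g ℂ) * z = 0 := by
    have : (2 : ℂ) • ((z : Pre g ℂ) * (z : Pre g ℂ)) = 0 := by
      rw [two_smul]
      nth_rewrite 1 [h1]
      exact neg_add_cancel _
    exact (smul_eq_zero.1 this).resolve_left two_ne_zero
  refine Subtype.ext ?_
  change Ideal.Quotient.mk _ z * Ideal.Quotient.mk _ z = 0
  rw [← map_mul, show z * z = 0 from Subtype.ext h2, map_zero]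

theorem oddClasses_comm (r : Hev a) (hr : r ∈ oddClasses a) (s : Hev a) :
    ∃ s', r * s = s' * r := by
  obtain ⟨z, hz, h, rfl⟩ := hr
  obtain ⟨w, hw, rfl⟩ := evClass_surj s
  exact ⟨evClass _ (twCocycle_mem 1 hw), evClass_mul _ _ _ _
    (mul_eq_tw_mul (mem_evenCocycles hz) (mem_evenCocycles hw) 1 (by simpa using h))⟩

section rank
variable [FiniteDimensional ℂ g]

/-- The elements of a homogeneous basis of `g`. -/
def letter (j : (i : ZMod 2) × Fin (Module.finrank ℂ (part (g := g) i))) : Homog g :=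
  ⟨j.1, Module.finBasis ℂ (part j.1) j.2, (Module.finBasis ℂ (part j.1) j.2).2⟩

theorem eq_zero_of_letters {f : Pre g ℂ} (hf : Lin f)
    (h : ∀ p : List ((i : ZMod 2) × Fin (Module.finrank ℂ (part (g := g) i))),
      f (p.map letter) = 0) : f = 0 := by
  funext l
  suffices H : ∀ (l : List (Homog g))
      (p : List ((i : ZMod 2) × Fin (Module.finrank ℂ (part (g := g) i)))),
      f (p.map letter ++ l) = 0 from H l []
  intro l
  induction l with
  | nil => intro p; simpa using h p
  | cons x l ih =>
    intro p
    have hz (i : ZMod 2) : f (p.map letter ++ (⟨i, 0, zero_mem _⟩ : Homog g) :: l) = 0 := by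
      have := hf (p.map letter) l 1 ⟨i, 0, zero_mem _⟩ ⟨i, 0, zero_mem _⟩ ⟨i, 0, zero_mem _⟩ rfl rfl
        (by simp)
      simpa using this
    let T : part (g := g) x.par →ₗ[ℂ] ℂ :=
      { toFun := fun v => f (p.map letter ++ (⟨x.par, v, v.2⟩ : Homog g) :: l)
        map_add' := fun v w => by
          have := hf (p.map letter) l 1 ⟨x.par, (v + w : part (g := g) x.par), (v + w).2⟩
            ⟨x.par, v, v.2⟩ ⟨x.par, w, w.2⟩ rfl rfl (by simp)
          simpa using this
        map_smul' := fun c v => by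
          have := hf (p.map letter) l c ⟨x.par, (c • v : part (g := g) x.par), (c • v).2⟩
            ⟨x.par, v, v.2⟩ ⟨x.par, 0, zero_mem _⟩ rfl rfl (by simp)
          rw [hz, add_zero] at this
          exact this }
    have hT : T = 0 := by
      refine (Module.finBasis ℂ (part (g := g) x.par)).ext fun j => ?_
      have := ih (p ++ [⟨x.par, j⟩])
      simp only [List.map_append, List.append_assoc] at this
      exact this
    exact congrArg (fun S : part (g := g) x.par →ₗ[ℂ] ℂ => S ⟨x.val, x.mem⟩) hT

theorem rank_Hev : Module.rank ℂ (Hev a) ≤ Cardinal.aleph0 := by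
  let J := (i : ZMod 2) × Fin (Module.finrank ℂ (part (g := g) i))
  have hfin (f : Pre g ℂ) (hf : IsCochain a f) :
      (Function.support fun p : List J => f (p.map letter)).Finite := by
    obtain ⟨n, hn⟩ := hf.bounded
    refine (List.finite_length_lt J n).subset fun p hp => ?_
    by_contra hlt
    exact hp (hn _ (by simpa using hlt))
  let T : cocycles a ℂ →ₗ[ℂ] (List J →₀ ℂ) :=
    { toFun := fun z => Finsupp.ofSupportFinite (fun p => (z : Pre g ℂ) (p.map letter))
        (hfin z z.2.1)
      map_add' := fun z w => Finsupp.ext fun p => rfl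
      map_smul' := fun c z => Finsupp.ext fun p => rfl }
  have hT : Function.Injective T := by
    rw [← LinearMap.ker_eq_bot, LinearMap.ker_eq_bot']
    intro z hz
    refine Subtype.ext (eq_zero_of_letters z.2.1.lin fun p => ?_)
    exact DFunLike.congr_fun hz p
  have h1 : Module.rank ℂ (cocycles a ℂ) ≤ Cardinal.aleph0 := by
    have h := LinearMap.lift_rank_le_of_injective T hT
    rw [← Cardinal.lift_le_aleph0]
    refine h.trans ?_
    rw [Cardinal.lift_le_aleph0, rank_finsupp_self]
    simp
  exact (Submodule.rank_le (Subalgebra.toSubmodule (Hev a))).trans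
    ((LinearMap.rank_le_of_surjective (Ideal.Quotient.mkₐ ℂ (coboundaries a ℂ)).toLinearMap
      Ideal.Quotient.mk_surjective).trans h1)

/-- The preimage of a maximal ideal under restriction is a maximal ideal. -/
theorem resEv_comap_isMaximal {m : Ideal (Hev a)} (hm : m.IsMaximal) :
    (m.comap (resEv a)).IsMaximal :=
  comap_isMaximal (resEv a) (fun _ => rfl) m hm.ne_top
    (exists_sub_algebraMap_mem (rank_Hev (a := a)) (oddClasses a) (Hev_decomp (a := a))
      (oddClasses_sq (a := a)) (oddClasses_comm (a := a)) m hm)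

end rank
end maximal

/-- A module over the Lie superalgebra `g`: a `ℤ/2`-graded vector space `M = M₀ ⊕ M₁` with a
homomorphism of Lie superalgebras `g → gl(M)`. -/
structure SuperModule (g : Type u) [AddCommGroup g] [Module ℂ g] [LieSuperalgebra g] where
  carrier : Type v
  [addCommGroup : AddCommGroup carrier]
  [module : Module ℂ carrier]
  part : ZMod 2 → Submodule ℂ carrier
  isCompl : IsCompl (part 0) (part 1)
  ρ : g →ₗ[ℂ] carrier →ₗ[ℂ] carrier
  ρ_mem : ∀ {i j : ZMod 2} {x : g} {v : carrier}, x ∈ LieSuperalgebra.part i → v ∈ part j →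
    ρ x v ∈ part (i + j)
  ρ_bracket : ∀ {i j : ZMod 2} {x y : g} (v : carrier), x ∈ LieSuperalgebra.part i →
    y ∈ LieSuperalgebra.part j → ρ (bracket x y) v = ρ x (ρ y v) - sgn (i * j) • ρ y (ρ x v)

attribute [instance] SuperModule.addCommGroup SuperModule.module

section grading
variable {V : Type v} [AddCommGroup V] [Module ℂ V] {p : ZMod 2 → Submodule ℂ V}
  (hp : IsCompl (p 0) (p 1))

/-- The projection of `V = V₀ ⊕ V₁` onto the part of parity `i`. -/
def proj (i : ZMod 2) : V →ₗ[ℂ] V :=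
  if i = 0 then (p 0).projection (p 1) hp else (p 1).projection (p 0) hp.symm

/-- The parity operator of `V = V₀ ⊕ V₁`: it is `(-1)^i` on the part of parity `i`. -/
def sigma : V →ₗ[ℂ] V := proj hp 0 - proj hp 1

theorem proj_add (v : V) : proj hp 0 v + proj hp 1 v = v := by
  simpa [proj] using Submodule.projection_add_projection_eq_self hp v

theorem proj_mem (i : ZMod 2) (v : V) : proj hp i v ∈ p i := by
  rcases zmod_two_cases i with rfl | rfl <;> simp [proj]

theorem proj_of_mem {i j : ZMod 2} {v : V} (hv : v ∈ p j) :
    proj hp i v = if i = j then v else 0 := by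
  rcases zmod_two_cases i with rfl | rfl <;> rcases zmod_two_cases j with rfl | rfl <;>
    simp [proj, hv]

theorem sigma_of_mem {i : ZMod 2} {v : V} (hv : v ∈ p i) : sigma hp v = sgn i • v := by
  rcases zmod_two_cases i with rfl | rfl <;> simp [sigma, proj_of_mem hp hv]

theorem induction_parts {p : ZMod 2 → Submodule ℂ V} (hp : IsCompl (p 0) (p 1)) {P : V → Prop} (hadd : ∀ v w, P v → P w → P (v + w))
    (h : ∀ i, ∀ v ∈ p i, P v) (v : V) : P v := by
  rw [← proj_add hp v]
  exact hadd _ _ (h 0 _ (proj_mem hp 0 v)) (h 1 _ (proj_mem hp 1 v))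

theorem sigma_sigma (v : V) : sigma hp (sigma hp v) = v := by
  induction v using induction_parts hp with
  | hadd v w hv hw => rw [map_add, map_add, hv, hw]
  | h i v hv => rw [sigma_of_mem hp hv, map_smul, sigma_of_mem hp hv, smul_smul, sgn_mul_self,
      one_smul]

end grading

namespace SuperModule
variable {g : Type u} [AddCommGroup g] [Module ℂ g] [LieSuperalgebra g] (M N : SuperModule.{u, v} g)

/-- The parity operator of a module, as an endomorphism. -/
def S : Module.End ℂ M.carrier := sigma M.isCompl

theorem S_S : M.S * M.S = 1 := LinearMap.ext fun v => sigma_sigma M.isCompl v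

theorem S_ρ (x : Homog g) : M.S * M.ρ x.val = sgn x.par • (M.ρ x.val * M.S) := by
  refine LinearMap.ext fun v => ?_
  induction v using induction_parts M.isCompl with
  | hadd v w hv hw => rw [map_add, map_add, hv, hw]
  | h i v hv =>
    have h1 := sigma_of_mem M.isCompl hv
    have h2 := sigma_of_mem M.isCompl (M.ρ_mem x.mem hv)
    simp only [Module.End.mul_apply, LinearMap.smul_apply, S, h1, h2, map_smul, sgn_add, mul_smul]

/-- The superalgebra `End M`.  A homogeneous `x` acts by the supercommutator
`x.φ = x ∘ φ - (-1)^(x̄ φ̄) φ ∘ x`. -/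
instance endSuperalgebra : GSuperalgebra g (Module.End ℂ M.carrier) where
  σ := AlgHom.ofLinearMap
    (LinearMap.mulLeft ℂ M.S ∘ₗ LinearMap.mulRight ℂ M.S)
    (by simpa using M.S_S) (fun φ ψ => by
      simp only [LinearMap.comp_apply, LinearMap.mulLeft_apply, LinearMap.mulRight_apply]
      calc M.S * (φ * ψ * M.S) = M.S * (φ * 1 * ψ * M.S) := by rw [mul_one]
        _ = M.S * (φ * M.S) * (M.S * (ψ * M.S)) := by rw [← M.S_S]; noncomm_ring)
  σ_σ φ := by
    simp only [AlgHom.ofLinearMap_apply, LinearMap.comp_apply, LinearMap.mulLeft_apply,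
      LinearMap.mulRight_apply]
    calc M.S * (M.S * (φ * M.S) * M.S) = (M.S * M.S) * φ * (M.S * M.S) := by noncomm_ring
      _ = φ := by rw [M.S_S, one_mul, mul_one]
  act x := LinearMap.mulLeft ℂ (M.ρ x.val) -
    LinearMap.mulRight ℂ (M.ρ x.val) ∘ₗ
      (if x.par = 0 then LinearMap.id else LinearMap.mulLeft ℂ M.S ∘ₗ LinearMap.mulRight ℂ M.S)
  act_lin c x y z h1 h2 h3 := by
    refine LinearMap.ext fun φ => ?_
    rw [h1, h2, h3]
    split_ifs
    · simp only [map_add, map_smul, LinearMap.sub_apply, LinearMap.comp_apply, LinearMap.add_apply,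
        LinearMap.smul_apply, LinearMap.mulLeft_apply, LinearMap.mulRight_apply, LinearMap.id_apply,
        add_mul, mul_add, smul_mul_assoc, mul_smul_comm]
      module
    · simp only [map_add, map_smul, LinearMap.sub_apply, LinearMap.comp_apply, LinearMap.add_apply,
        LinearMap.smul_apply, LinearMap.mulLeft_apply, LinearMap.mulRight_apply,
        add_mul, mul_add, smul_mul_assoc, mul_smul_comm]
      module
  σ_act x φ := by
    have h1 := M.S_ρ x
    have h2 (z : Module.End ℂ M.carrier) :
        M.S * (M.ρ x.val * z) = sgn x.par • (M.ρ x.val * (M.S * z)) := by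
      rw [← mul_assoc, h1, smul_mul_assoc, mul_assoc]
    have h3 (z : Module.End ℂ M.carrier) : M.S * (M.S * z) = z := by
      rw [← mul_assoc, M.S_S, one_mul]
    rcases zmod_two_cases x.par with h | h <;>
    simp only [AlgHom.ofLinearMap_apply, LinearMap.sub_apply, LinearMap.comp_apply,
      LinearMap.mulLeft_apply, LinearMap.mulRight_apply, LinearMap.id_apply, mul_sub, sub_mul,
      mul_assoc, h1, h2, h3, h, sgn_zero, sgn_one, one_smul, neg_smul, mul_neg, if_true, one_ne_zero,
      if_false, M.S_S, mul_one, smul_sub, neg_mul]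
  act_mul x φ ψ := by
    have h3 (z : Module.End ℂ M.carrier) : M.S * (M.S * z) = z := by
      rw [← mul_assoc, M.S_S, one_mul]
    rcases zmod_two_cases x.par with h | h <;>
    simp only [AlgHom.ofLinearMap_apply, LinearMap.sub_apply, LinearMap.comp_apply,
      LinearMap.mulLeft_apply, LinearMap.mulRight_apply, LinearMap.id_apply, mul_sub, sub_mul,
      mul_assoc, h3, h, if_true, one_ne_zero, if_false] <;> abel
  act_br x y φ := by
    have h1 := M.S_ρ x
    have h1' := M.S_ρ y
    have h2 (z : Module.End ℂ M.carrier) :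
        M.S * (M.ρ x.val * z) = sgn x.par • (M.ρ x.val * (M.S * z)) := by
      rw [← mul_assoc, h1, smul_mul_assoc, mul_assoc]
    have h2' (z : Module.End ℂ M.carrier) :
        M.S * (M.ρ y.val * z) = sgn y.par • (M.ρ y.val * (M.S * z)) := by
      rw [← mul_assoc, h1', smul_mul_assoc, mul_assoc]
    have h3 (z : Module.End ℂ M.carrier) : M.S * (M.S * z) = z := by
      rw [← mul_assoc, M.S_S, one_mul]
    have hb : M.ρ (x.br y).val =
        M.ρ x.val * M.ρ y.val - sgn (x.par * y.par) • (M.ρ y.val * M.ρ x.val) :=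
      LinearMap.ext fun v => M.ρ_bracket v x.mem y.mem
    have hp : (x.br y).par = x.par + y.par := rfl
    have h11 : (1 : ZMod 2) + 1 = 0 := by decide
    rcases zmod_two_cases x.par with h | h <;> rcases zmod_two_cases y.par with h' | h' <;>
    simp only [LinearMap.sub_apply, LinearMap.comp_apply,
      LinearMap.mulLeft_apply, LinearMap.mulRight_apply, LinearMap.id_apply, mul_sub, sub_mul,
      mul_assoc, h1, h2, h1', h2', h3, h, h', hb, hp, h11, sgn_zero, sgn_one, one_smul, neg_smul,
      mul_neg, neg_mul, if_true, one_ne_zero, if_false, M.S_S, mul_one, smul_sub, mul_zero, add_zero,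
      zero_add] <;> abel

variable {M N}

/-- The bilinear action of `g` on the tensor product of two modules:
`x (m ⊗ n) = x m ⊗ n + (-1)^(x̄ m̄) m ⊗ x n` for homogeneous `x` and `m`. -/
def tensorρ (M N : SuperModule.{u, v} g) :
    g →ₗ[ℂ] (M.carrier ⊗[ℂ] N.carrier) →ₗ[ℂ] (M.carrier ⊗[ℂ] N.carrier) where
  toFun x := TensorProduct.map (M.ρ x) LinearMap.id +
    TensorProduct.map LinearMap.id (N.ρ (proj LieSuperalgebra.isCompl 0 x)) +
    TensorProduct.map M.S (N.ρ (proj LieSuperalgebra.isCompl 1 x))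
  map_add' x y := by
    simp only [map_add, TensorProduct.map_add_left, TensorProduct.map_add_right]
    abel
  map_smul' c x := by
    simp only [map_smul, TensorProduct.map_smul_left, TensorProduct.map_smul_right, smul_add,
      RingHom.id_apply]

theorem tensorρ_tmul {i j : ZMod 2} {x : g} {m : M.carrier} (hx : x ∈ LieSuperalgebra.part i)
    (hm : m ∈ M.part j) (n : N.carrier) : tensorρ M N x (m ⊗ₜ n) =
      M.ρ x m ⊗ₜ n + sgn (i * j) • (m ⊗ₜ[ℂ] N.ρ x n) := by
  have h : M.S m = sgn j • m := sigma_of_mem M.isCompl hm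
  rcases zmod_two_cases i with rfl | rfl <;>
    simp [tensorρ, proj_of_mem LieSuperalgebra.isCompl hx, h, TensorProduct.smul_tmul']

/-- The grading of the tensor product: `(M ⊗ N)ₖ = ⨁ᵢ Mᵢ ⊗ Nₖ₋ᵢ`. -/
def tensorPart (M N : SuperModule.{u, v} g) (k : ZMod 2) :
    Submodule ℂ (M.carrier ⊗[ℂ] N.carrier) :=
  ⨆ i : ZMod 2, Submodule.map₂ (TensorProduct.mk ℂ M.carrier N.carrier) (M.part i) (N.part (k - i))

theorem tmul_mem {i j k : ZMod 2} (h : i + j = k) {m : M.carrier} {n : N.carrier}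
    (hm : m ∈ M.part i) (hn : n ∈ N.part j) : m ⊗ₜ n ∈ tensorPart M N k := by
  refine (le_iSup (fun i : ZMod 2 => Submodule.map₂ (TensorProduct.mk ℂ M.carrier N.carrier)
    (M.part i) (N.part (k - i))) i) (Submodule.apply_mem_map₂ _ hm ?_)
  rwa [← h, add_sub_cancel_left]

theorem tensorPart_le {k : ZMod 2} {P : Submodule ℂ (M.carrier ⊗[ℂ] N.carrier)}
    (h : ∀ i j, i + j = k → ∀ m ∈ M.part i, ∀ n ∈ N.part j, m ⊗ₜ n ∈ P) : tensorPart M N k ≤ P :=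
  iSup_le fun i => Submodule.map₂_le.2 fun m hm n hn =>
    h i (k - i) (add_sub_cancel _ _) m hm n hn

theorem tensor_induction {P : M.carrier ⊗[ℂ] N.carrier → Prop}
    (hadd : ∀ v w, P v → P w → P (v + w))
    (h : ∀ i j, ∀ m ∈ M.part i, ∀ n ∈ N.part j, P (m ⊗ₜ n)) (v : M.carrier ⊗[ℂ] N.carrier) :
    P v := by
  induction v using TensorProduct.induction_on with
  | zero => simpa using h 0 0 0 (zero_mem _) 0 (zero_mem _)
  | tmul m n =>
    induction m using induction_parts M.isCompl with
    | hadd m m' hm hm' => rw [TensorProduct.add_tmul]; exact hadd _ _ hm hm'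
    | h i m hm =>
      induction n using induction_parts N.isCompl with
      | hadd n n' hn hn' => rw [TensorProduct.tmul_add]; exact hadd _ _ hn hn'
      | h j n hn => exact h i j m hm n hn
  | add v w hv hw => exact hadd v w hv hw

theorem tensorPart_isCompl : IsCompl (tensorPart M N 0) (tensorPart M N 1) := by
  have key (k : ZMod 2) : ∀ v ∈ tensorPart M N k, TensorProduct.map M.S N.S v = sgn k • v := by
    have : tensorPart M N k ≤ LinearMap.eqLocus (TensorProduct.map M.S N.S)
        (sgn k • LinearMap.id) := tensorPart_le fun i j hij m hm n hn => by
      rw [LinearMap.mem_eqLocus, TensorProduct.map_tmul, S, S, sigma_of_mem M.isCompl hm,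
        sigma_of_mem N.isCompl hn, TensorProduct.smul_tmul_smul, ← sgn_add, hij]
      rfl
    exact fun v hv => this hv
  constructor
  · rw [Submodule.disjoint_def]
    intro v h0 h1
    have := (key 0 v h0).symm.trans (key 1 v h1)
    simp only [sgn_zero, sgn_one, one_smul, neg_smul] at this
    have h2 : (2 : ℂ) • v = 0 := by
      rw [two_smul]
      nth_rewrite 1 [this]
      exact neg_add_cancel v
    exact (smul_eq_zero.1 h2).resolve_left two_ne_zero
  · rw [codisjoint_iff, eq_top_iff]
    intro v _
    induction v using tensor_induction with
    | hadd v w hv hw => exact add_mem (hv trivial) (hw trivial)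
    | h i j m hm n hn =>
      have h := tmul_mem (M := M) (N := N) rfl hm hn
      rcases zmod_two_cases (i + j) with e | e <;> rw [e] at h
      · exact Submodule.mem_sup_left h
      · exact Submodule.mem_sup_right h

/-- The tensor product of two modules. -/
def tensor (M N : SuperModule.{u, v} g) : SuperModule.{u, v} g where
  carrier := M.carrier ⊗[ℂ] N.carrier
  part := tensorPart M N
  isCompl := tensorPart_isCompl
  ρ := tensorρ M N
  ρ_mem {i j x v} hx hv := by
    have : tensorPart M N j ≤ (tensorPart M N (i + j)).comap (tensorρ M N x) :=
      tensorPart_le fun k l hkl m hm n hn => by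
        rw [Submodule.mem_comap, tensorρ_tmul hx hm]
        refine add_mem (tmul_mem ?_ (M.ρ_mem hx hm) hn)
          (Submodule.smul_mem _ _ (tmul_mem ?_ hm (N.ρ_mem hx hn)))
        · rw [← hkl, add_assoc]
        · rw [← hkl, add_left_comm]
    exact this hv
  ρ_bracket {i j x y} v hx hy := by
    induction v using tensor_induction with
    | hadd v w hv hw => simp only [map_add, hv, hw, smul_add]; abel
    | h k l m hm n hn =>
      have hxy := LieSuperalgebra.bracket_mem hx hy
      rw [tensorρ_tmul hxy hm, tensorρ_tmul hx hm, tensorρ_tmul hy hm, map_add, map_add, map_smul,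
        map_smul, tensorρ_tmul hx hm, tensorρ_tmul hy hm, tensorρ_tmul hx (M.ρ_mem hy hm),
        tensorρ_tmul hy (M.ρ_mem hx hm), M.ρ_bracket m hx hy, N.ρ_bracket n hx hy]
      simp only [TensorProduct.sub_tmul, TensorProduct.tmul_sub, TensorProduct.tmul_smul,
        ← TensorProduct.smul_tmul', add_mul, mul_add, sgn_add, mul_comm j i]
      rcases sgn_cases (i * j) with h | h <;> rcases sgn_cases (i * k) with h' | h' <;>
        rcases sgn_cases (j * k) with h'' | h'' <;> rw [h, h', h''] <;> module

end SuperModule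

section varieties
variable {g : Type u} [AddCommGroup g] [Module ℂ g] [LieSuperalgebra g]

/-- `Ext^•_{(g, a)}(M, M) = H^•(g, a; End M)`, the relative cohomology with coefficients in the
`g`-module of all linear endomorphisms of `M`. -/
abbrev Ext (a : EvenSubalgebra g) (M : SuperModule.{u, v} g) : Type _ :=
  Cohomology a (Module.End ℂ M.carrier)

/-- The cup product action of `H^{ev}(g, a; ℂ)` on `Ext^•_{(g, a)}(M, M)`. -/
instance (a : EvenSubalgebra g) (M : SuperModule.{u, v} g) : Module (Hev a) (Ext a M) :=
  Module.compHom (Ext a M)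
    ((cohomologyCoeff a (Module.End ℂ M.carrier)).comp (Hev a).val.toRingHom)

/-- The cohomology variety `V_{(g, a)}(ℂ)`: the maximal ideals of `H^{ev}(g, a; ℂ)`.  Classes of odd
parity in `H^{ev}(g, a; ℂ)` square to zero and commute with the other classes up to sign, so they lie
in every maximal left ideal; in particular every maximal left ideal is two-sided. -/
def CohomologyVariety (a : EvenSubalgebra g) : Type _ := {m : Ideal (Hev a) // m.IsMaximal}

/-- The support variety `V_{(g, a)}(M)`: the zero set in `V_{(g, a)}(ℂ)` of the annihilator of
`Ext^•_{(g, a)}(M, M)` in `H^{ev}(g, a; ℂ)`. -/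
def supportVariety (a : EvenSubalgebra g) (M : SuperModule.{u, v} g) : Set (CohomologyVariety a) :=
  {m | Module.annihilator (Hev a) (Ext a M) ≤ m.1}

/-- The realization map `Φ : V_{(g, a)}(ℂ) → V_{(g, g₀)}(ℂ)` induced by the restriction homomorphism:
a maximal ideal of `H^{ev}(g, a; ℂ)` is sent to its preimage in `H^{ev}(g, g₀; ℂ)`. -/
def realization [FiniteDimensional ℂ g] (a : EvenSubalgebra g) :
    CohomologyVariety a → CohomologyVariety (evenPart g) :=
  fun m => ⟨m.1.comap (resEv a), resEv_comap_isMaximal m.2⟩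

/-- The tensor product theorem for the pair `(g, a)`, for the modules in the class `C`. -/
def SatisfiesTensorProductTheorem (a : EvenSubalgebra g) (C : Set (SuperModule.{u, v} g)) : Prop :=
  ∀ M ∈ C, ∀ N ∈ C,
    supportVariety a (M.tensor N) = supportVariety a M ∩ supportVariety a N

/-- The `g`-module `M` is natural with respect to `a`. -/
def SuperModule.IsNatural [FiniteDimensional ℂ g] (M : SuperModule.{u, v} g)
    (a : EvenSubalgebra g) : Prop :=
  supportVariety (evenPart g) M ∩ Set.range (realization a) = realization a '' supportVariety a M

/-- The subalgebra `a` is natural: every module in the class `C` is natural with respect to `a`. -/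
def EvenSubalgebra.IsNatural [FiniteDimensional ℂ g] (a : EvenSubalgebra g)
    (C : Set (SuperModule.{u, v} g)) : Prop :=
  ∀ M ∈ C, M.IsNatural a

end varieties

end SuperCohomology

end

open SuperCohomology

theorem proposition5p4 {g : Type u} [AddCommGroup g] [Module ℂ g] [FiniteDimensional ℂ g]
    [LieSuperalgebra g] (C : Set (SuperModule.{u, v} g))
    (hC : ∀ M ∈ C, ∀ N ∈ C, M.tensor N ∈ C)
    (hg : SatisfiesTensorProductTheorem (evenPart g) C)
    (a : EvenSubalgebra g) (ha : a.IsNatural C)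
    (M : SuperModule.{u, v} g) (hM : M ∈ C) (N : SuperModule.{u, v} g) (hN : N ∈ C) :
    realization a '' supportVariety a (M.tensor N) =
      realization a '' supportVariety a M ∩ realization a '' supportVariety a N := by
  -- By naturality, each image is a support variety over `g₀` cut down to the range of the realization
  -- map, and `C` is closed under tensor products, so this applies to `M ⊗ N` as well.
  rw [← ha _ (hC M hM N hN), ← ha M hM, ← ha N hN, hg M hM N hN, Set.inter_inter_distrib_right]
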